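/- Let $V:\mathbb R\to\mathbb R$ be integrable, $\|V\|_1=\int_{\mathbb R}|V(x)|\,dx$, and let $J(x)=-1$ where $V(x)<0$ and $J(x)=1$ elsewhere, so that $V=\sqrt{|V|}\,J\sqrt{|V|}$. With the principal branch of the square root put, for $z\in\mathbb C\setminus\{0\}$ and $x,y\in\mathbb R$, $$R_\infty(z;x,y)=\mp\frac{i}{2\sqrt z}\,e^{\pm i\sqrt z\,|x-y|}\quad\text{for }\pm\operatorname{Im}\sqrt z>0 ,$$ which is the integral kernel of the free resolvent $(z+\tfrac{d^2}{dx^2})^{-1}$ on $L^2(\mathbb R)$. For $z=\nu\in(0,\infty)$ there are two boundary values $R_\infty^\pm(\nu;x,y)=\mp\frac{i}{2\sqrt\nu}e^{\pm i\sqrt\nu|x-y|}$. Let $K_\infty(z)=\sqrt{|V|}\,R_\infty(z)\sqrt{|V|}\,J$ be the Birman–Schwinger operator, i.e. the bounded integral operator on $L^2(\mathbb R)$ with kernel $\sqrt{|V(x)|}\,R_\infty(z;x,y)\sqrt{|V(y)|}\,J(y)$; for $z=\nu\in(0,\infty)$ the symbol $K_\infty(z)$ stands for either of the two operators $K_\infty^\pm(\nu)$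 obtained from $R_\infty^\pm(\nu;x,y)$, and every assertion is made for both. For $q>0$ let $\ell^q(L^1(\mathbb R))$ be the set of all $W\in L^1(\mathbb R)$ with $\sum_{j\in\mathbb Z}\bigl(\int_j^{j+1}|W(x)|\,dx\bigr)^q<\infty$, and let $(X^2V)(x)=x^2V(x)$. Then the following hold. 1. For every $z\in\mathbb C\setminus[-\tfrac14\|V\|_1^2,\infty)$ the operator $1-K_\infty(z)$ has a bounded inverse on $L^2(\mathbb R)$. 2. Suppose in addition that $V\in\ell^{1/2}(L^1(\mathbb R))$ and $X^2V\in\ell^{1/2}(L^1(\mathbb R))$. Then for every $z\in\mathbb C\setminus[-\tfrac14\|V\|_1^2,0]$ the operator $K_\infty(z)$ is trace class, $1-K_\infty(z)$ has a bounded inverse and, equivalently, its Fredholm determinant satisfies $\det(1-K_\infty(z))\neq0$. Moreover, for every compact set $D\subset\mathbb C\setminus[-\tfrac14\|V\|_1^2,0]$ there is a constant $c>0$ such that $|\det(1-K_\infty(z))|\ge c$ for all $z\in D$. -/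

import Mathlib

open MeasureTheory Filter Topology

noncomputable section

/-! ### The Birman–Solomyak classes -/

/-- `V ∈ ℓ^q(L¹(ℝ))`: `V ∈ L¹(ℝ)` and `∑_{j ∈ ℤ} ‖V χ_{[j,j+1]}‖₁ ^ q < ∞`. -/
def MemBirmanSolomyak (q : ℝ) (V : ℝ → ℝ) : Prop :=
  Integrable V ∧ Summable fun j : ℤ => (∫ x in Set.Icc (j : ℝ) (j + 1), |V x|) ^ q

/-- The norm `‖V‖₁` of an integrable potential. -/
def potentialNorm (V : ℝ → ℝ) : ℝ := ∫ x, |V x|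

/-! ### Trace class operators and the Fredholm determinant -/

section Determinant

universe u

variable {H : Type u} [NormedAddCommGroup H] [InnerProductSpace ℂ H]

/-- `A` is trace class: `A = ∑ₙ ⟪gₙ, ·⟫ fₙ` with `∑ₙ ‖fₙ‖ ‖gₙ‖ < ∞`. -/
def IsTraceClass (A : H →L[ℂ] H) : Prop :=
  ∃ f g : ℕ → H, (Summable fun n => ‖f n‖ * ‖g n‖) ∧
    ∀ x, HasSum (fun n => inner ℂ (g n) x • f n) (A x)

open Classical in
/-- `d` is the determinant of `T`: in every orthonormal basis, the determinants of the finite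
sections `(⟪bᵢ, T bⱼ⟫)_{i,j ∈ F}` converge to `d` along the finite sets `F` of indices. If `T - 1`
is trace class, there is exactly one such `d`, the Fredholm determinant of `T`. -/
def HasFredholmDet (T : H →L[ℂ] H) (d : ℂ) : Prop :=
  ∀ (ι : Type u) (b : HilbertBasis ι ℂ H),
    Tendsto (fun F : Finset ι => (Matrix.of fun i j : F => inner ℂ (b i) (T (b j))).det)
      atTop (𝓝 d)

open Classical in
/-- The Fredholm determinant `det T`. The value is `0` if `T` has no determinant in the sense of
`HasFredholmDet`. -/
def fredholmDet (T : H →L[ℂ] H) : ℂ :=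
  if h : ∃ d, HasFredholmDet T d then h.choose else 0

end Determinant

/-! ### The free Green function -/

/-- The side from which the cut `(0, ∞)` is approached: `upper` stands for the boundary value `+`
and `lower` for the boundary value `-`. -/
inductive CutSide
  | upper
  | lower

open Classical in
/-- The integral kernel of the free resolvent `R_∞(z) = (z + d²/dx²)⁻¹` on `L²(ℝ)`, with the
principal branch of the square root: `∓ i / (2 √z) * exp (± i √z |x - y|)` for `± Im √z > 0`. For
`z ∈ (0, ∞)`, where `Im √z = 0`, the side `s` selects one of the two boundary values; for all other
`z ≠ 0` it has no influence. -/
def greenFn (s : CutSide) (z : ℂ) (x y : ℝ) : ℂ :=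
  if 0 < (Complex.sqrt z).im ∨ ((Complex.sqrt z).im = 0 ∧ s = CutSide.upper) then
    -(Complex.I / (2 * Complex.sqrt z)) * Complex.exp (Complex.I * Complex.sqrt z * |x - y|)
  else
    Complex.I / (2 * Complex.sqrt z) * Complex.exp (-(Complex.I * Complex.sqrt z * |x - y|))

theorem continuous_greenFn (s : CutSide) (z : ℂ) :
    Continuous fun p : ℝ × ℝ => greenFn s z p.1 p.2 := by
  unfold greenFn
  split_ifs <;> fun_prop

theorem norm_greenFn_le (s : CutSide) (z : ℂ) (x y : ℝ) :
    ‖greenFn s z x y‖ ≤ ‖Complex.I / (2 * Complex.sqrt z)‖ := by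
  unfold greenFn
  split_ifs with h
  · rw [norm_mul, norm_neg]
    refine mul_le_of_le_one_right (norm_nonneg _) ?_
    rw [Complex.norm_exp, Real.exp_le_one_iff]
    have h0 : 0 ≤ (Complex.sqrt z).im := by
      rcases h with h | h
      · exact h.le
      · exact h.1.ge
    simp only [Complex.mul_re, Complex.I_re, Complex.I_im, Complex.mul_im, Complex.ofReal_re,
      Complex.ofReal_im]
    nlinarith [mul_nonneg h0 (abs_nonneg (x - y))]
  · rw [norm_mul]
    refine mul_le_of_le_one_right (norm_nonneg _) ?_
    rw [Complex.norm_exp, Real.exp_le_one_iff]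
    have h0 : (Complex.sqrt z).im ≤ 0 := not_lt.mp fun h' => h (Or.inl h')
    simp only [Complex.mul_re, Complex.I_re, Complex.I_im, Complex.mul_im, Complex.ofReal_re,
      Complex.ofReal_im, Complex.neg_re]
    nlinarith [mul_nonneg (neg_nonneg.mpr h0) (abs_nonneg (x - y))]

/-! ### The Birman–Schwinger operator -/

/-- The multiplier `J` in the factorization `V = √|V| J √|V|`, `J² = 1`. -/
def signJ (V : ℝ → ℝ) (x : ℝ) : ℝ := if V x < 0 then -1 else 1

/-- The kernel `√|V(x)| R_∞(z; x, y) √|V(y)| J(y)`. -/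
def bsKernel (V : ℝ → ℝ) (s : CutSide) (z : ℂ) (x y : ℝ) : ℂ :=
  (√|V x| : ℝ) * greenFn s z x y * ((√|V y| * signJ V y : ℝ) : ℂ)

/-- The Hilbert space `L²(ℝ)`. -/
abbrev L2R : Type := Lp ℂ 2 (volume : Measure ℝ)

theorem memLp_sqrtAbs {V : ℝ → ℝ} (hV : Integrable V) :
    MemLp (fun x => ((√|V x| : ℝ) : ℂ)) 2 := by
  have hm : AEStronglyMeasurable (fun x => ((√|V x| : ℝ) : ℂ)) volume := by
    have h := hV.aemeasurable
    have : AEMeasurable (fun x => ((√|V x| : ℝ) : ℂ)) volume := by fun_prop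
    exact this.aestronglyMeasurable
  rw [memLp_two_iff_integrable_sq_norm hm]
  refine hV.abs.congr (ae_of_all _ fun x => ?_)
  simp [Complex.norm_real, Real.sq_sqrt]

theorem memLp_sqrtAbs_mul_signJ {V : ℝ → ℝ} (hV : Integrable V) :
    MemLp (fun x => ((√|V x| * signJ V x : ℝ) : ℂ)) 2 := by
  have hm : AEStronglyMeasurable (fun x => ((√|V x| * signJ V x : ℝ) : ℂ)) volume := by
    have h := hV.aemeasurable
    have hφ : Measurable fun t : ℝ => ((√|t| * (if t < 0 then -1 else 1) : ℝ) : ℂ) := by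
      have : Measurable fun t : ℝ => if t < 0 then (-1 : ℝ) else 1 :=
        Measurable.ite measurableSet_Iio measurable_const measurable_const
      fun_prop
    exact (hφ.comp_aemeasurable h).aestronglyMeasurable
  refine (memLp_sqrtAbs hV).of_le hm (ae_of_all _ fun x => ?_)
  unfold signJ
  split_ifs <;> simp

theorem integrable_sqrtAbs_mul_signJ_mul {V : ℝ → ℝ} (hV : Integrable V) (f : L2R) :
    Integrable fun y => ((√|V y| * signJ V y : ℝ) : ℂ) * f y :=
  (memLp_sqrtAbs_mul_signJ hV).integrable_mul (Lp.memLp f)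

theorem integrable_greenFn_mul {s : CutSide} {z : ℂ} {g : ℝ → ℂ} (hg : Integrable g) (x : ℝ) :
    Integrable fun y => greenFn s z x y * g y := by
  refine hg.bdd_mul (c := ‖Complex.I / (2 * Complex.sqrt z)‖) ?_
    (ae_of_all _ fun y => norm_greenFn_le s z x y)
  exact ((continuous_greenFn s z).comp (by fun_prop : Continuous fun y : ℝ => (x, y))
    ).aestronglyMeasurable

theorem integral_bsKernel_mul (V : ℝ → ℝ) (s : CutSide) (z : ℂ) (f : ℝ → ℂ) (x : ℝ) :
    ∫ y, bsKernel V s z x y * f y =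
      (√|V x| : ℝ) * ∫ y, greenFn s z x y * (((√|V y| * signJ V y : ℝ) : ℂ) * f y) := by
  rw [← integral_const_mul]
  congr 1
  ext y
  unfold bsKernel
  ring

theorem integrable_bsKernel_mul {V : ℝ → ℝ} (hV : Integrable V) (s : CutSide) (z : ℂ)
    (f : L2R) (x : ℝ) : Integrable fun y => bsKernel V s z x y * f y := by
  refine ((integrable_greenFn_mul (s := s) (z := z)
    (integrable_sqrtAbs_mul_signJ_mul hV f) x).const_mul ((√|V x| : ℝ) : ℂ)).congr
      (ae_of_all _ fun y => ?_)
  simp only [bsKernel]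
  ring

theorem norm_integral_bsKernel_mul_le {V : ℝ → ℝ} (hV : Integrable V) (s : CutSide) (z : ℂ)
    (f : L2R) (x : ℝ) :
    ‖∫ y, bsKernel V s z x y * f y‖ ≤
      (‖Complex.I / (2 * Complex.sqrt z)‖ * (‖(memLp_sqrtAbs_mul_signJ hV).toLp‖ * ‖f‖)) *
        ‖((√|V x| : ℝ) : ℂ)‖ := by
  have hg := integrable_sqrtAbs_mul_signJ_mul hV f
  rw [integral_bsKernel_mul, norm_mul, mul_comm]
  refine mul_le_mul_of_nonneg_right ?_ (norm_nonneg _)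
  calc ‖∫ y, greenFn s z x y * (((√|V y| * signJ V y : ℝ) : ℂ) * f y)‖
      ≤ ∫ y, ‖Complex.I / (2 * Complex.sqrt z)‖ * ‖((√|V y| * signJ V y : ℝ) : ℂ) * f y‖ := by
        refine norm_integral_le_of_norm_le (hg.norm.const_mul _) (ae_of_all _ fun y => ?_)
        rw [norm_mul]
        exact mul_le_mul_of_nonneg_right (norm_greenFn_le s z x y) (norm_nonneg _)
    _ = ‖Complex.I / (2 * Complex.sqrt z)‖ *
          ∫ y, ‖((√|V y| * signJ V y : ℝ) : ℂ) * f y‖ := integral_const_mul _ _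
    _ ≤ _ := by
        refine mul_le_mul_of_nonneg_left ?_ (norm_nonneg _)
        rw [integral_norm_eq_lintegral_enorm hg.1, ← eLpNorm_one_eq_lintegral_enorm,
          Lp.norm_toLp, Lp.norm_def, ← ENNReal.toReal_mul]
        refine ENNReal.toReal_mono
          (ENNReal.mul_ne_top (memLp_sqrtAbs_mul_signJ hV).2.ne (Lp.memLp f).2.ne) ?_
        have h := eLpNorm_smul_le_mul_eLpNorm (p := 2) (q := 2) (r := 1) (μ := volume)
          (f := (f : ℝ → ℂ)) (φ := fun y => ((√|V y| * signJ V y : ℝ) : ℂ))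
          (Lp.memLp f).1 (memLp_sqrtAbs_mul_signJ hV).1
        simpa only [smul_eq_mul, Pi.mul_def] using h

theorem memLp_integral_bsKernel_mul {V : ℝ → ℝ} (hV : Integrable V) (s : CutSide) (z : ℂ)
    (f : L2R) : MemLp (fun x => ∫ y, bsKernel V s z x y * f y) 2 := by
  refine (memLp_sqrtAbs hV).of_le_mul ?_
    (ae_of_all _ fun x => norm_integral_bsKernel_mul_le hV s z f x)
  simp_rw [integral_bsKernel_mul]
  refine (memLp_sqrtAbs hV).1.mul ?_
  have h1 : AEStronglyMeasurable (fun p : ℝ × ℝ => greenFn s z p.1 p.2)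
      ((volume : Measure ℝ).prod volume) := (continuous_greenFn s z).aestronglyMeasurable
  have h2 : AEStronglyMeasurable
      (fun p : ℝ × ℝ => ((√|V p.2| * signJ V p.2 : ℝ) : ℂ) * f p.2)
      ((volume : Measure ℝ).prod volume) :=
    (integrable_sqrtAbs_mul_signJ_mul hV f).1.comp_snd
  exact (h1.mul h2).integral_prod_right'

/-- The Birman–Schwinger operator `K_∞(z) = √|V| R_∞(z) √|V| J` on `L²(ℝ)`, the bounded integral
operator with the kernel `bsKernel V s z`. For `z = ν > 0` it is the boundary value `K_∞^±(ν)` on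
the side `s` of the cut. -/
def birmanSchwinger (V : ℝ → ℝ) (hV : Integrable V) (s : CutSide) (z : ℂ) : L2R →L[ℂ] L2R :=
  LinearMap.mkContinuous
    { toFun := fun f => (memLp_integral_bsKernel_mul hV s z f).toLp
      map_add' := fun f g => by
        rw [← MemLp.toLp_add]
        refine MemLp.toLp_congr _ _ (ae_of_all _ fun x => ?_)
        simp only [Pi.add_apply]
        rw [← integral_add (integrable_bsKernel_mul hV s z f x)
          (integrable_bsKernel_mul hV s z g x)]
        refine integral_congr_ae ?_
        filter_upwards [Lp.coeFn_add f g] with y hy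
        rw [hy, Pi.add_apply, mul_add]
      map_smul' := fun c f => by
        rw [RingHom.id_apply, ← MemLp.toLp_const_smul]
        refine MemLp.toLp_congr _ _ (ae_of_all _ fun x => ?_)
        simp only [Pi.smul_apply, smul_eq_mul]
        rw [← integral_const_mul]
        refine integral_congr_ae ?_
        filter_upwards [Lp.coeFn_smul c f] with y hy
        rw [hy, Pi.smul_apply, smul_eq_mul]
        ring }
    (‖Complex.I / (2 * Complex.sqrt z)‖ * ‖(memLp_sqrtAbs_mul_signJ hV).toLp‖ *
      ‖(memLp_sqrtAbs hV).toLp‖)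
    (fun f => by
      have h := Lp.norm_le_mul_norm_of_ae_le_mul (p := 2) (μ := (volume : Measure ℝ))
        (f := (memLp_integral_bsKernel_mul hV s z f).toLp) (g := (memLp_sqrtAbs hV).toLp)
        (c := ‖Complex.I / (2 * Complex.sqrt z)‖ *
          (‖(memLp_sqrtAbs_mul_signJ hV).toLp‖ * ‖f‖)) (by
          filter_upwards [(memLp_integral_bsKernel_mul hV s z f).coeFn_toLp,
            (memLp_sqrtAbs hV).coeFn_toLp] with x h1 h2
          rw [h1, h2]
          exact norm_integral_bsKernel_mul_le hV s z f x)
      refine h.trans (le_of_eq ?_)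
      ring)

theorem birmanSchwinger_ae {V : ℝ → ℝ} (hV : Integrable V) (s : CutSide) (z : ℂ) (f : L2R) :
    birmanSchwinger V hV s z f =ᵐ[volume] fun x => ∫ y, bsKernel V s z x y * f y :=
  (memLp_integral_bsKernel_mul hV s z f).coeFn_toLp

end

/-! ### Hadamard's inequality for Gram-type determinants -/

section Hadamard

variable {H : Type*} [NormedAddCommGroup H] [InnerProductSpace ℂ H]

/-! Let `κ` be the square root of `z` with `Im κ ≥ 0` that belongs to the chosen side, so that the
free kernel is `-i/(2κ) exp(iκ|x-y|)` in every case.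

Invertibility. The kernel is bounded by `1/(2|κ|)`, hence `‖K‖ ≤ ‖V‖₁/(2|κ|)`, and a Neumann series
settles `|z| > ‖V‖₁²/4`. For `z` nonreal or positive `K` is compact (for positive `z`, under the
`ℓ^{1/2}` condition), and it remains to exclude `Kf = f`. Put `g = √|V| J f` and `ψ = R g`. Then `f
= √|V| ψ`, so `⟨g, Rg⟩ = ∫ V|ψ|²` is real and the anti-Hermitian part of `R` has zero form at `g`.
For nonreal `z` the resolvent identity makes this form a nonzero multiple of `‖ψ‖²`
(`integral_conj_greenFn_mul_eq_zero`). For `z > 0` it is a multiple of `|ĝ(κ)|² + |ĝ(-κ)|²`; the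
vanishing of these two values turns `ψ = Rg` into a Volterra inequality on `(x, ∞)`, which forces `ψ
= 0` (`integral_greenFn_mul_eq_zero_of_real`, `volterra_zero`).

Determinant. Cut the line into unit cells. Off the diagonal `exp(iκ|x-y|)` has rank one on each
block; on a diagonal block it is an absolutely convergent Fourier series in `x - y`
(`hasSum_block`). This writes `K` as a nuclear series `∑ ⟪gₙ, ·⟫ fₙ`. The sum of the principal
minors of `(⟪gᵢ, fⱼ⟫)` is dominated, by Hadamard's inequality, by `∑ₛ ∏_{i∈s} ‖fᵢ‖‖gᵢ‖`. Hence it is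
the limit of the finite sections in any basis, depends continuously on `κ`, and is nonzero if `1 -
K` is invertible (`IsNuclearSum.nuclearDet_ne_zero`). The lower bound on `D` is a minimum over the
compact set of all `κ` with `Im κ ≥ 0` and `κ² ∈ D`. -/

theorem norm_orthonormalBasis_det_le {n : ℕ} (b : OrthonormalBasis (Fin n) ℂ H) (v : Fin n → H) :
    ‖b.toBasis.det v‖ ≤ ∏ i, ‖v i‖ := by
  have : FiniteDimensional ℂ H := b.toBasis.finiteDimensional_of_finite
  have hdim : Module.finrank ℂ H = Fintype.card (Fin n) := Module.finrank_eq_card_basis b.toBasis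
  -- In the Gram–Schmidt basis of `v` the coordinate matrix is triangular, and a change of
  -- orthonormal basis has determinant of modulus one.
  let c := InnerProductSpace.gramSchmidtOrthonormalBasis hdim v
  have hc : c.toBasis.det v = ∏ i, inner ℂ (c i) (v i) :=
    InnerProductSpace.gramSchmidtOrthonormalBasis_det hdim v
  rw [b.toBasis.det.eq_smul_basis_det c.toBasis, AlternatingMap.smul_apply, norm_smul,
    OrthonormalBasis.coe_toBasis, b.det_to_matrix_orthonormalBasis c, one_mul, hc, norm_prod]
  refine Finset.prod_le_prod (fun i _ => norm_nonneg _) fun i _ => ?_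
  simpa [c.orthonormal.1 i] using norm_inner_le_norm (𝕜 := ℂ) (c i) (v i)

theorem det_inner_eq_zero_of_not_linearIndependent {ι : Type*} [Fintype ι] [DecidableEq ι]
    (g f : ι → H) (hf : ¬ LinearIndependent ℂ f) :
    (Matrix.of fun i j => inner ℂ (g i) (f j)).det = 0 := by
  obtain ⟨c, hc, i, hi⟩ := Fintype.not_linearIndependent_iff.1 hf
  refine Matrix.exists_mulVec_eq_zero_iff.1 ⟨c, fun h => hi (congrFun h i), ?_⟩
  ext k
  have : ∑ j, inner ℂ (g k) (f j) * c j = inner ℂ (g k) (∑ j, c j • f j) := by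
    simp [mul_comm]
  simp [Matrix.mulVec, dotProduct, this, hc]

/-- Only the projections of the `gᵢ` to the span of the `fⱼ` matter. If the `fⱼ` are independent,
this span has dimension `n` and the matrix is a product of two square coordinate matrices, to each
of which Hadamard's inequality applies. -/
theorem norm_det_inner_fin_le {n : ℕ} (g f : Fin n → H) :
    ‖(Matrix.of fun i j => inner ℂ (g i) (f j)).det‖ ≤ (∏ i, ‖g i‖) * ∏ i, ‖f i‖ := by
  by_cases hf : LinearIndependent ℂ f
  swap
  · rw [det_inner_eq_zero_of_not_linearIndependent g f hf, norm_zero]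
    positivity
  let W := Submodule.span ℂ (Set.range f)
  have : FiniteDimensional ℂ W := FiniteDimensional.span_of_finite ℂ (Set.finite_range f)
  have hW : Module.finrank ℂ W = n := by
    simpa using finrank_span_eq_card hf
  let b : OrthonormalBasis (Fin n) ℂ W := (stdOrthonormalBasis ℂ W).reindex (finCongr hW)
  let f' : Fin n → W := fun i => ⟨f i, Submodule.subset_span ⟨i, rfl⟩⟩
  let g' : Fin n → W := fun i => W.orthogonalProjectionOnto (g i)
  have hgf : ∀ i j, inner ℂ (g i) (f j) = inner ℂ (g' i) (f' j) := fun i j => by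
    exact (W.inner_orthogonalProjectionOnto_eq_of_mem_right (f' j) (g i)).symm
  have hM : (Matrix.of fun i j => inner ℂ (g i) (f j)) =
      (b.toBasis.toMatrix g').conjTranspose * b.toBasis.toMatrix f' := by
    ext i j
    rw [Matrix.of_apply, hgf, ← b.sum_inner_mul_inner, Matrix.mul_apply]
    refine Finset.sum_congr rfl fun k _ => ?_
    simp [Module.Basis.toMatrix_apply, OrthonormalBasis.repr_apply_apply, Matrix.conjTranspose_apply]
  rw [hM, Matrix.det_mul, Matrix.det_conjTranspose, norm_mul, norm_star]
  refine mul_le_mul ((norm_orthonormalBasis_det_le b g').trans ?_)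
    (norm_orthonormalBasis_det_le b f') (norm_nonneg _) (by positivity)
  exact Finset.prod_le_prod (fun i _ => norm_nonneg _) fun i _ =>
    W.norm_orthogonalProjectionOnto_apply_le (g i)

theorem norm_det_inner_le {ι : Type*} [Fintype ι] [DecidableEq ι] (g f : ι → H) :
    ‖(Matrix.of fun i j => inner ℂ (g i) (f j)).det‖ ≤ ∏ i, ‖f i‖ * ‖g i‖ := by
  let e := Fintype.equivFin ι
  have h := norm_det_inner_fin_le (g ∘ e.symm) (f ∘ e.symm)
  have hM : (Matrix.of fun i j => inner ℂ ((g ∘ e.symm) i) ((f ∘ e.symm) j)) =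
      (Matrix.of fun i j => inner ℂ (g i) (f j)).submatrix e.symm e.symm := rfl
  rw [hM, Matrix.det_submatrix_equiv_self] at h
  rw [Finset.prod_mul_distrib, mul_comm]
  simpa only [Function.comp_apply, e.symm.prod_comp fun i => ‖g i‖,
    e.symm.prod_comp fun i => ‖f i‖] using h

end Hadamard

/-! ### Expansion of determinants in principal minors -/

/-- Multilinearity in the rows: `s` records the rows taken from `-M`, and the identity rows
elsewhere cut the determinant down to the minor on `s`. -/
theorem Matrix.det_one_sub_eq_sum_minors {n R : Type*} [CommRing R] [Fintype n] [DecidableEq n]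
    (M : Matrix n n R) :
    (1 - M).det = ∑ s : Finset n,
      (-1) ^ s.card * (M.submatrix (Subtype.val : s → n) (Subtype.val : s → n)).det := by
  have h1 : (1 - M).det = Matrix.detRowAlternating ((-M).row + (1 : Matrix n n R).row) := by
    rw [Matrix.detRowAlternating]
    congr 1
    ext i j
    rw [sub_eq_neg_add]
    rfl
  rw [h1, AlternatingMap.map_add_univ]
  refine Finset.sum_congr rfl fun s _ => ?_
  have h2 := Matrix.det_piecewise_one_eq_submatrix_det (-M) s
  refine h2.trans ?_
  rw [Matrix.submatrix_neg]
  simp [Matrix.det_neg]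

/-! ### The determinant of a nuclear series -/

section NuclearDet

universe u

variable {H : Type u} [NormedAddCommGroup H] [InnerProductSpace ℂ H] {N : Type*}

open Classical in
/-- The Fredholm determinant of `1 - ∑ₙ ⟪gₙ, ·⟫ fₙ`, as the sum of its principal minors. -/
noncomputable def nuclearDet (f g : N → H) : ℂ :=
  ∑' s : Finset N, (-1) ^ s.card * (Matrix.of fun i j : s => inner ℂ (g i) (f j)).det

theorem norm_nuclearDet_term_le [DecidableEq N] (f g : N → H) (s : Finset N) :
    ‖(-1) ^ s.card * (Matrix.of fun i j : s => inner ℂ (g i) (f j)).det‖ ≤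
      ∏ i ∈ s, ‖f i‖ * ‖g i‖ := by
  rw [norm_mul, norm_pow, norm_neg, norm_one, one_pow, one_mul]
  refine (norm_det_inner_le (fun i : s => g i) fun i : s => f i).trans (le_of_eq ?_)
  exact Finset.prod_coe_sort s fun i => ‖f i‖ * ‖g i‖

/-- Dominated convergence over the finite index sets, with majorant `∏_{i∈s} bound i` from
Hadamard's inequality. Convergence of the individual inner products suffices; the vectors themselves
need not converge. -/
theorem tendsto_nuclearDet {α : Type*} {l : Filter α} {f g : α → N → H} {f₀ g₀ : N → H}
    {bound : N → ℝ} (hb : Summable bound)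
    (hfg : ∀ m n, Tendsto (fun a => inner ℂ (g a m) (f a n)) l (𝓝 (inner ℂ (g₀ m) (f₀ n))))
    (hbd : ∀ᶠ a in l, ∀ n, ‖f a n‖ * ‖g a n‖ ≤ bound n) :
    Tendsto (fun a => nuclearDet (f a) (g a)) l (𝓝 (nuclearDet f₀ g₀)) := by
  classical
  -- Nonnegativity of `bound` is read off at a single index `a`, which exists only for a nontrivial
  -- filter.
  rcases l.eq_or_neBot with rfl | hl
  · exact tendsto_bot
  have hb0 : ∀ n, 0 ≤ bound n := by
    obtain ⟨a, ha⟩ := hbd.exists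
    exact fun n => le_trans (by positivity) (ha n)
  unfold nuclearDet
  refine tendsto_tsum_of_dominated_convergence
    (bound := fun s => ∏ i ∈ s, bound i) (summable_finsetProd_of_summable_nonneg hb0 hb) ?_ ?_
  · intro s
    refine Tendsto.const_mul _ ?_
    refine ((Continuous.matrix_det continuous_id).tendsto _).comp ?_
    exact tendsto_pi_nhds.2 fun i => tendsto_pi_nhds.2 fun j => hfg i j
  · filter_upwards [hbd] with a ha s
    refine le_trans ?_ (Finset.prod_le_prod (fun i _ => by positivity) fun i _ => ha i)
    convert norm_nuclearDet_term_le (f a) (g a) s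

theorem hasSum_nuclearDet [DecidableEq N] {f g : N → H} {bound : N → ℝ} (hb : Summable bound)
    (hbd : ∀ n, ‖f n‖ * ‖g n‖ ≤ bound n) :
    HasSum (fun s : Finset N =>
      (-1) ^ s.card * (Matrix.of fun i j : s => inner ℂ (g i) (f j)).det) (nuclearDet f g) := by
  have h : Summable fun s : Finset N =>
      (-1) ^ s.card * (Matrix.of fun i j : s => inner ℂ (g i) (f j)).det := by
    refine Summable.of_norm_bounded (summable_finsetProd_of_summable_nonneg
      (fun n => le_trans (by positivity) (hbd n)) hb) fun s => ?_
    exact (norm_nuclearDet_term_le f g s).trans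
      (Finset.prod_le_prod (fun i _ => by positivity) fun i _ => hbd i)
  unfold nuclearDet
  convert h.hasSum

theorem nuclearDet_zero_right (f : N → H) : nuclearDet f (fun _ => 0) = 1 := by
  classical
  unfold nuclearDet
  rw [tsum_eq_single ∅]
  · simp
  · intro s hs
    obtain ⟨i, hi⟩ := Finset.nonempty_iff_ne_empty.2 hs
    rw [Matrix.det_eq_zero_of_row_eq_zero ⟨i, hi⟩ (by simp), mul_zero]

theorem tendsto_finset_powerset_atTop :
    Tendsto (Finset.powerset : Finset N → Finset (Finset N)) atTop atTop := by
  classical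
  refine tendsto_atTop_finset_of_monotone (fun s t h => Finset.powerset_mono.2 h) fun s => ?_
  exact ⟨s, Finset.mem_powerset_self s⟩

/-! ### Finite sections of a nuclear series -/

/-- The orthogonal projection onto the span of a finite orthonormal family. -/
noncomputable def finiteProj {F : Type*} [Fintype F] (e : F → H) : H →L[ℂ] H :=
  ∑ i, (innerSL ℂ (e i)).smulRight (e i)

theorem finiteProj_apply {F : Type*} [Fintype F] (e : F → H) (x : H) :
    finiteProj e x = ∑ i, inner ℂ (e i) x • e i := by
  simp [finiteProj]

theorem inner_finiteProj_left {F : Type*} [Fintype F] (e : F → H) (x y : H) :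
    inner ℂ (finiteProj e x) y = ∑ i, inner ℂ x (e i) * inner ℂ (e i) y := by
  simp [finiteProj_apply, mul_comm]

theorem inner_finiteProj_comm {F : Type*} [Fintype F] (e : F → H) (x y : H) :
    inner ℂ (finiteProj e x) y = inner ℂ x (finiteProj e y) := by
  rw [inner_finiteProj_left, finiteProj_apply, inner_sum]
  simp [inner_smul_right, mul_comm]

theorem finiteProj_apply_self {F : Type*} [Fintype F] {e : F → H} (he : Orthonormal ℂ e) (i : F) :
    finiteProj e (e i) = e i := by
  classical
  rw [finiteProj_apply, Finset.sum_eq_single i]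
  · simp [he.1 i]
  · intro j _ hj
    simp [he.2 hj]
  · simp

theorem norm_finiteProj_le {F : Type*} [Fintype F] {e : F → H} (he : Orthonormal ℂ e) (x : H) :
    ‖finiteProj e x‖ ≤ ‖x‖ := by
  have h1 : finiteProj e (finiteProj e x) = finiteProj e x := by
    conv_lhs => rw [finiteProj_apply e x, map_sum]
    simp_rw [map_smul, finiteProj_apply_self he]
    exact (finiteProj_apply e x).symm
  have h2 : ‖finiteProj e x‖ ^ 2 ≤ ‖x‖ * ‖finiteProj e x‖ := by
    rw [← inner_self_eq_norm_sq (𝕜 := ℂ), inner_finiteProj_comm, h1]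
    exact (RCLike.re_le_norm _).trans (norm_inner_le_norm _ _)
  by_contra! h
  nlinarith [norm_nonneg x]

/-- The determinant of a finite section of a nuclear series. -/
theorem det_one_sub_eq_nuclearDet {F : Type*} [Fintype F] [DecidableEq F] {e : F → H}
    (he : Orthonormal ℂ e) {f g : N → H} (hs : Summable fun n => ‖f n‖ * ‖g n‖)
    {M : Matrix F F ℂ}
    (hM : ∀ i j, HasSum (fun n => inner ℂ (e i) (f n) * inner ℂ (g n) (e j)) (M i j)) :
    (1 - M).det = nuclearDet f fun n => finiteProj e (g n) := by
  classical
  have hpart : ∀ T : Finset N,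
      (1 - Matrix.of fun i j => ∑ n ∈ T, inner ℂ (e i) (f n) * inner ℂ (g n) (e j)).det =
      ∑ s ∈ T.powerset, (-1) ^ s.card *
        (Matrix.of fun i j : s => inner ℂ (finiteProj e (g i)) (f j)).det := by
    intro T
    have h1 : (Matrix.of fun i j => ∑ n ∈ T, inner ℂ (e i) (f n) * inner ℂ (g n) (e j)) =
        (Matrix.of fun (i : F) (n : T) => inner ℂ (e i) (f n)) *
          (Matrix.of fun (n : T) (j : F) => inner ℂ (g n) (e j)) := by
      ext i j
      simp only [Matrix.of_apply, Matrix.mul_apply]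
      exact (Finset.sum_coe_sort T fun n => inner ℂ (e i) (f n) * inner ℂ (g n) (e j)).symm
    have h2 : (Matrix.of fun (n : T) (j : F) => inner ℂ (g n) (e j)) *
        (Matrix.of fun (i : F) (n : T) => inner ℂ (e i) (f n)) =
        Matrix.of fun m n : T => inner ℂ (finiteProj e (g m)) (f n) := by
      ext m n
      simp only [Matrix.of_apply, Matrix.mul_apply, inner_finiteProj_left]
    -- `det (1 - XY) = det (1 - YX)` trades the section indexed by `F` for a matrix indexed by the
    -- terms `T` of the truncated series; there the projection acts on the `gₙ` alone.
    rw [h1, Matrix.det_one_sub_mul_comm, h2, Matrix.det_one_sub_eq_sum_minors]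
    refine Finset.sum_bij' (fun s _ => s.map (Function.Embedding.subtype _))
      (fun s _ => s.subtype (· ∈ T)) ?_ ?_ ?_ ?_ ?_
    · intro s _
      rw [Finset.mem_powerset]
      intro x hx
      obtain ⟨y, _, rfl⟩ := Finset.mem_map.1 hx
      exact y.2
    · simp
    · intro s _
      ext x
      simp
    · intro s hs
      rw [Finset.subtype_map, Finset.filter_true_of_mem (fun x hx => Finset.mem_powerset.1 hs hx)]
    · intro s _
      rw [Finset.card_map]
      congr 1
      let φ : s ≃ (s.map (Function.Embedding.subtype (· ∈ T))) := Equiv.ofBijective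
        (fun x => ⟨x.1.1, Finset.mem_map_of_mem (Function.Embedding.subtype (· ∈ T)) x.2⟩)
        ⟨fun x y h => Subtype.ext (Subtype.ext (Subtype.mk.inj h)), fun ⟨y, hy⟩ => by
          obtain ⟨x, hx, rfl⟩ := Finset.mem_map.1 hy
          exact ⟨⟨x, hx⟩, rfl⟩⟩
      rw [← Matrix.det_submatrix_equiv_self φ]
      rfl
  have hlim1 : Tendsto (fun T : Finset N =>
      (1 - Matrix.of fun i j => ∑ n ∈ T, inner ℂ (e i) (f n) * inner ℂ (g n) (e j)).det) atTop
      (𝓝 (1 - M).det) := by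
    have hc : Continuous fun A : Matrix F F ℂ => (1 - A).det :=
      Continuous.matrix_det (continuous_const.sub continuous_id)
    refine (hc.tendsto M).comp ?_
    exact tendsto_pi_nhds.2 fun i => tendsto_pi_nhds.2 fun j => hM i j
  have hlim2 := (hasSum_nuclearDet (f := f) (g := fun n => finiteProj e (g n)) hs fun n =>
    mul_le_mul_of_nonneg_left (norm_finiteProj_le he (g n)) (norm_nonneg _)).comp
      (tendsto_finset_powerset_atTop (N := N))
  -- As `T` grows, the determinants converge by continuity and their minor expansions converge
  -- because the powersets of `T` exhaust all finite index sets.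
  refine tendsto_nhds_unique hlim1 (hlim2.congr fun T => ?_)
  rw [hpart T]
  rfl

/-! ### Operators given by a nuclear series and their determinants -/

/-- `A = ∑ₙ ⟪gₙ, ·⟫ fₙ` with `∑ₙ ‖fₙ‖ ‖gₙ‖ < ∞`. -/
structure IsNuclearSum (A : H →L[ℂ] H) (f g : N → H) : Prop where
  summable : Summable fun n => ‖f n‖ * ‖g n‖
  hasSum : ∀ x, HasSum (fun n => inner ℂ (g n) x • f n) (A x)

theorem IsNuclearSum.hasSum_inner {A : H →L[ℂ] H} {f g : N → H} (h : IsNuclearSum A f g)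
    (x y : H) : HasSum (fun n => inner ℂ x (f n) * inner ℂ (g n) y) (inner ℂ x (A y)) := by
  have := (innerSL ℂ x).hasSum (h.hasSum y)
  simpa [inner_smul_right, mul_comm] using this

theorem IsNuclearSum.isTraceClass [Denumerable N] {A : H →L[ℂ] H} {f g : N → H}
    (h : IsNuclearSum A f g) : IsTraceClass A := by
  let e := (Denumerable.eqv N).symm
  refine ⟨f ∘ e, g ∘ e, ?_, fun x => ?_⟩
  · exact (e.summable_iff (f := fun n => ‖f n‖ * ‖g n‖)).2 h.summable
  · exact (e.hasSum_iff (f := fun n => inner ℂ (g n) x • f n)).2 (h.hasSum x)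

/-- The series of rank one operators converges absolutely in operator norm, and norm limits of
compact operators are compact. -/
theorem IsNuclearSum.isCompactOperator [CompleteSpace H] {A : H →L[ℂ] H} {f g : N → H}
    (h : IsNuclearSum A f g) : IsCompactOperator A := by
  let R : N → H →L[ℂ] H := fun n => (innerSL ℂ (g n)).smulRight (f n)
  have hR : Summable R := by
    refine Summable.of_norm_bounded h.summable fun n => ?_
    rw [ContinuousLinearMap.norm_smulRight_apply, innerSL_apply_norm, mul_comm]
  have hA : HasSum R A := by
    convert hR.hasSum
    ext x
    refine (h.hasSum x).unique ?_
    simpa [R] using (ContinuousLinearMap.apply ℂ H x).hasSum hR.hasSum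
  refine isCompactOperator_of_tendsto hA (Eventually.of_forall fun T => ?_)
  induction T using Finset.cons_induction with
  | empty => simpa using isCompactOperator_zero
  | cons n T hn ih =>
    rw [Finset.sum_cons]
    refine IsCompactOperator.add ?_ ih
    have h1 : IsCompactOperator (innerSL ℂ (g n)) :=
      isCompactOperator_of_locallyCompactSpace_dom (innerSL ℂ (g n))
    exact h1.clm_comp (ContinuousLinearMap.toSpanSingleton ℂ (f n))

theorem tendsto_finiteProj {ι : Type*} (b : HilbertBasis ι ℂ H) (x : H) :
    Tendsto (fun F : Finset ι => finiteProj (fun i : F => b i) x) atTop (𝓝 x) := by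
  refine Tendsto.congr (fun F => ?_) (b.hasSum_repr x)
  rw [finiteProj_apply, ← Finset.sum_coe_sort F]
  simp [HilbertBasis.repr_apply_apply]

theorem orthonormal_finset {ι : Type*} (b : HilbertBasis ι ℂ H) (F : Finset ι) :
    Orthonormal ℂ fun i : F => b i :=
  b.orthonormal.comp _ Subtype.val_injective

theorem one_eq_inner {F : Type*} [DecidableEq F] {e : F → H} (he : Orthonormal ℂ e) :
    (1 : Matrix F F ℂ) = Matrix.of fun i j => inner ℂ (e i) (e j) := by
  ext i j
  rw [Matrix.of_apply, Matrix.one_apply, orthonormal_iff_ite.1 he]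

theorem IsNuclearSum.det_section {F : Type*} [Fintype F] [DecidableEq F] {e : F → H}
    (he : Orthonormal ℂ e) {A : H →L[ℂ] H} {f g : N → H} (h : IsNuclearSum A f g) :
    (Matrix.of fun i j => inner ℂ (e i) ((1 - A) (e j))).det =
      nuclearDet f fun n => finiteProj e (g n) := by
  rw [← det_one_sub_eq_nuclearDet he h.summable
    (M := Matrix.of fun i j => inner ℂ (e i) (A (e j))) fun i j => h.hasSum_inner _ _,
    one_eq_inner he]
  congr 1
  ext i j
  simp

/-- Passing to a finite section replaces `gₙ` by `P gₙ`, where `P gₙ → gₙ` and `‖P gₙ‖ ≤ ‖gₙ‖`. The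
limit does not involve the basis, which gives the basis independence required by `HasFredholmDet`.
-/
theorem IsNuclearSum.tendsto_det_section {ι : Type*} [DecidableEq ι] (b : HilbertBasis ι ℂ H)
    {A : H →L[ℂ] H} {f g : N → H} (h : IsNuclearSum A f g) :
    Tendsto (fun F : Finset ι => (Matrix.of fun i j : F => inner ℂ (b i) ((1 - A) (b j))).det)
      atTop (𝓝 (nuclearDet f g)) := by
  refine Tendsto.congr (fun F => (h.det_section (orthonormal_finset b F)).symm) ?_
  refine tendsto_nuclearDet h.summable (fun m n => ?_) (Eventually.of_forall fun F n => ?_)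
  · exact (tendsto_finiteProj b (g m)).inner tendsto_const_nhds
  · exact mul_le_mul_of_nonneg_left (norm_finiteProj_le (orthonormal_finset b F) (g n))
      (norm_nonneg _)

theorem IsNuclearSum.hasFredholmDet {A : H →L[ℂ] H} {f g : N → H} (h : IsNuclearSum A f g) :
    HasFredholmDet (1 - A) (nuclearDet f g) := by
  intro ι b
  classical
  convert h.tendsto_det_section b

theorem HasFredholmDet.unique [CompleteSpace H] {T : H →L[ℂ] H} {d d' : ℂ}
    (h : HasFredholmDet T d) (h' : HasFredholmDet T d') : d = d' := by
  obtain ⟨w, b, -⟩ := exists_hilbertBasis ℂ H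
  exact tendsto_nhds_unique (h w b) (h' w b)

theorem IsNuclearSum.fredholmDet_eq [CompleteSpace H] {A : H →L[ℂ] H} {f g : N → H}
    (h : IsNuclearSum A f g) : fredholmDet (1 - A) = nuclearDet f g := by
  have hex : ∃ d, HasFredholmDet (1 - A) d := ⟨_, h.hasFredholmDet⟩
  rw [fredholmDet, dif_pos hex]
  exact hex.choose_spec.unique h.hasFredholmDet

/-- Write a right inverse of `1 - A` as `1 - B`. The product of the sections of `1 - A` and `1 - B`
is the section of `1 - A(1-P)B`, and this correction disappears as `P → 1`. So the product of the
two limiting determinants is `1`. -/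
theorem IsNuclearSum.nuclearDet_ne_zero [CompleteSpace H] {A : H →L[ℂ] H} {f g : N → H}
    (h : IsNuclearSum A f g) (hA : IsUnit (1 - A)) : nuclearDet f g ≠ 0 := by
  classical
  obtain ⟨T, hT⟩ := hA.exists_right_inv
  have hTB : (1 - A) * (1 - (1 - T)) = 1 := by rw [sub_sub_cancel, hT]
  -- Thus `B = -AT` is nuclear, with the same `fₙ` and with `-T* gₙ` in place of `gₙ`.
  have hBT : 1 - T = -(A * T) := by
    have : T - A * T = 1 := by rw [← hT, sub_mul, one_mul]
    rw [← this]; abel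
  set B := 1 - T with hB
  have hadj : ∀ n, ‖ContinuousLinearMap.adjoint T (g n)‖ ≤ ‖T‖ * ‖g n‖ := fun n => by
    simpa using (ContinuousLinearMap.adjoint T).le_opNorm (g n)
  have hnB : IsNuclearSum B f fun n => -(ContinuousLinearMap.adjoint T (g n)) := by
    refine ⟨?_, fun x => ?_⟩
    · refine Summable.of_nonneg_of_le (fun n => by positivity) (fun n => ?_)
        (h.summable.mul_left ‖T‖)
      rw [norm_neg]
      calc ‖f n‖ * ‖ContinuousLinearMap.adjoint T (g n)‖ ≤ ‖f n‖ * (‖T‖ * ‖g n‖) :=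
            mul_le_mul_of_nonneg_left (hadj n) (norm_nonneg _)
        _ = ‖T‖ * (‖f n‖ * ‖g n‖) := by ring
    · rw [hBT]
      simpa [ContinuousLinearMap.adjoint_inner_left] using (h.hasSum (T x)).neg
  obtain ⟨w, b, -⟩ := exists_hilbertBasis ℂ H
  let P : Finset w → H →L[ℂ] H := fun F => finiteProj fun i : F => b i
  let B' := ContinuousLinearMap.adjoint B
  -- These vectors `B*(1-P)gₙ` are the functionals of `A(1-P)B`. They tend to `0` for each `n`, with
  -- norm at most `2‖B*‖‖gₙ‖`.
  let g' : Finset w → N → H := fun F n => B' (g n - P F (g n))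
  have hPn : ∀ F x, ‖x - P F x‖ ≤ 2 * ‖x‖ := fun F x => by
    have h1 := norm_sub_le x (P F x)
    have h2 : ‖P F x‖ ≤ ‖x‖ := norm_finiteProj_le (orthonormal_finset b F) x
    linarith
  have hg' : ∀ F n, ‖f n‖ * ‖g' F n‖ ≤ 2 * ‖B'‖ * (‖f n‖ * ‖g n‖) := fun F n => by
    have h1 : ‖g' F n‖ ≤ ‖B'‖ * (2 * ‖g n‖) :=
      (B'.le_opNorm _).trans (mul_le_mul_of_nonneg_left (hPn F _) (norm_nonneg _))
    calc ‖f n‖ * ‖g' F n‖ ≤ ‖f n‖ * (‖B'‖ * (2 * ‖g n‖)) :=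
          mul_le_mul_of_nonneg_left h1 (norm_nonneg _)
      _ = _ := by ring
  have hprod : ∀ F : Finset w,
      (Matrix.of fun i j : F => inner ℂ (b i) ((1 - A) (b j))).det *
        (Matrix.of fun i j : F => inner ℂ (b i) ((1 - B) (b j))).det =
      nuclearDet f fun n => P F (g' F n) := by
    intro F
    have he := orthonormal_finset b F
    rw [← det_one_sub_eq_nuclearDet he
      (M := Matrix.of fun i j : F => inner ℂ (b i) (A (B (b j) - P F (B (b j)))))
      (Summable.of_nonneg_of_le (fun n => by positivity) (hg' F)
        (h.summable.mul_left (2 * ‖B'‖))) fun i j => ?_, ← Matrix.det_mul]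
    · congr 1
      ext i j
      have hsum : ∀ x : H, P F x = ∑ k : F, inner ℂ (b k) x • b k := fun x => finiteProj_apply _ x
      have h1 : ∑ k : F, inner ℂ (b i) ((1 - A) (b k)) * inner ℂ (b k) ((1 - B) (b j)) =
          inner ℂ (b i) ((1 - A) (P F ((1 - B) (b j)))) := by
        rw [hsum, map_sum, inner_sum]
        refine Finset.sum_congr rfl fun k _ => ?_
        rw [map_smul, inner_smul_right, mul_comm]
      have hPb : ∀ k : F, P F (b k) = b k := fun k => finiteProj_apply_self he k
      have h2 : (1 - A) (P F ((1 - B) (b j))) =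
          b j + (1 - A) (B (b j) - P F (B (b j))) := by
        have h3 : (1 - A) ((1 - B) (b j)) = b j := by
          have := congrArg (fun S : H →L[ℂ] H => S (b j)) hTB
          simpa using this
        have h4 : P F ((1 - B) (b j)) = (1 - B) (b j) + (B (b j) - P F (B (b j))) := by
          simp only [sub_apply, one_apply_eq_self, map_sub, hPb]
          abel
        rw [h4, map_add, h3]
      have h5 : inner ℂ (b i) (B (b j) - P F (B (b j))) = 0 := by
        rw [inner_sub_right, ← inner_finiteProj_comm (fun i : F => b i)]
        change _ - inner ℂ (P F (b i)) _ = 0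
        rw [hPb, sub_self]
      rw [Matrix.mul_apply]
      simp only [Matrix.of_apply]
      rw [h1, h2, inner_add_right, sub_apply, inner_sub_right,
        one_apply_eq_self, h5, one_eq_inner he]
      simp only [Matrix.sub_apply, Matrix.of_apply]
      ring
    · refine (h.hasSum_inner (b i) (B (b j) - P F (B (b j)))).congr_fun fun n => ?_
      congr 1
      rw [ContinuousLinearMap.adjoint_inner_left, inner_sub_left, inner_sub_right]
      congr 1
      exact inner_finiteProj_comm _ _ _
  have hlim := (h.tendsto_det_section b).mul (hnB.tendsto_det_section b)
  have hlim1 : Tendsto (fun F : Finset w => nuclearDet f fun n => P F (g' F n)) atTop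
      (𝓝 (nuclearDet f fun _ => 0)) := by
    refine tendsto_nuclearDet (h.summable.mul_left (2 * ‖B'‖)) (fun m n => ?_)
      (Eventually.of_forall fun F n => ?_)
    · refine Tendsto.inner ?_ tendsto_const_nhds
      have h0 : Tendsto (fun F => g' F m) atTop (𝓝 0) := by
        have h1 : Tendsto (fun F => g m - P F (g m)) atTop (𝓝 0) := by
          simpa using (tendsto_const_nhds (x := g m)).sub (tendsto_finiteProj b (g m))
        have h2 := (B'.continuous.tendsto 0).comp h1
        rwa [map_zero] at h2
      refine squeeze_zero_norm (fun F => norm_finiteProj_le (orthonormal_finset b F) _) ?_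
      simpa using h0.norm
    · exact (mul_le_mul_of_nonneg_left (norm_finiteProj_le (orthonormal_finset b F) _)
        (norm_nonneg _)).trans (hg' F n)
  rw [nuclearDet_zero_right] at hlim1
  have := tendsto_nhds_unique (hlim.congr hprod) hlim1
  exact left_ne_zero_of_mul_eq_one this

theorem isUnit_one_sub_of_isCompactOperator [CompleteSpace H] {A : H →L[ℂ] H}
    (hA : IsCompactOperator A) (hinj : ∀ x, A x = x → x = 0) : IsUnit (1 - A) := by
  rcases hA.hasEigenvalue_or_mem_resolventSet (μ := (1 : ℂ)) one_ne_zero with h | h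
  · obtain ⟨x, hx⟩ := h.exists_hasEigenvector
    exact absurd (hinj x (by simpa using hx.apply_eq_smul)) hx.2
  · simpa [spectrum.mem_resolventSet_iff] using h

end NuclearDet

/-! ### Weighted vectors and separable expansions of the kernel -/

section WeightedVec

open ComplexConjugate

theorem L2R.norm_sq_eq_integral (w : L2R) : ‖w‖ ^ 2 = ∫ x, ‖w x‖ ^ 2 := by
  have h : (inner ℂ w w : ℂ) = ((∫ x, ‖w x‖ ^ 2 : ℝ) : ℂ) := by
    rw [L2.inner_def, ← integral_complex_ofReal]
    refine integral_congr_ae (ae_of_all _ fun x => ?_)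
    simp
  rw [inner_self_eq_norm_sq_to_K] at h
  exact Complex.ofReal_injective (by simpa using h)

theorem integral_norm_mul_norm_le (u v : L2R) : ∫ x, ‖u x‖ * ‖v x‖ ≤ ‖u‖ * ‖v‖ := by
  have h := integral_mul_le_Lp_mul_Lq_of_nonneg (μ := (volume : Measure ℝ))
    (p := 2) (q := 2) Real.HolderConjugate.two_two
    (f := fun x => ‖u x‖) (g := fun x => ‖v x‖) (ae_of_all _ fun x => norm_nonneg _)
    (ae_of_all _ fun x => norm_nonneg _)
    (by simpa using (Lp.memLp u).norm) (by simpa using (Lp.memLp v).norm)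
  refine h.trans (le_of_eq ?_)
  have hn : ∀ w : L2R, (∫ x, ‖w x‖ ^ (2 : ℝ)) ^ (1 / (2 : ℝ)) = ‖w‖ := fun w => by
    rw [← Real.sqrt_eq_rpow]
    simp only [Real.rpow_two]
    rw [← L2R.norm_sq_eq_integral, Real.sqrt_sq (norm_nonneg _)]
  rw [hn, hn]

theorem memLp_sqrtAbs_mul {V : ℝ → ℝ} (hV : Integrable V) {a : ℝ → ℂ}
    (ha : AEStronglyMeasurable a) (hb : ∀ x, ‖a x‖ ≤ 1) :
    MemLp (fun x => ((√|V x| : ℝ) : ℂ) * a x) 2 := by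
  refine (memLp_sqrtAbs hV).of_le ((memLp_sqrtAbs hV).1.mul ha) (ae_of_all _ fun x => ?_)
  rw [norm_mul]
  exact mul_le_of_le_one_right (norm_nonneg _) (hb x)

open Classical in
/-- The vector `√|V| a` of `L²(ℝ)`; it is `0` if the function is not square integrable. -/
noncomputable def weightedVec (V : ℝ → ℝ) (a : ℝ → ℂ) : L2R :=
  if h : MemLp (fun x => ((√|V x| : ℝ) : ℂ) * a x) 2 then h.toLp else 0

theorem weightedVec_ae {V : ℝ → ℝ} (hV : Integrable V) {a : ℝ → ℂ}
    (ha : AEStronglyMeasurable a) (hb : ∀ x, ‖a x‖ ≤ 1) :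
    weightedVec V a =ᵐ[volume] fun x => ((√|V x| : ℝ) : ℂ) * a x := by
  rw [weightedVec, dif_pos (memLp_sqrtAbs_mul hV ha hb)]
  exact (memLp_sqrtAbs_mul hV ha hb).coeFn_toLp

theorem inner_weightedVec_weightedVec {V : ℝ → ℝ} (hV : Integrable V) {a b : ℝ → ℂ}
    (ha : AEStronglyMeasurable a) (ha' : ∀ x, ‖a x‖ ≤ 1)
    (hb : AEStronglyMeasurable b) (hb' : ∀ x, ‖b x‖ ≤ 1) :
    inner ℂ (weightedVec V a) (weightedVec V b) = ∫ x, (|V x| : ℝ) * (conj (a x) * b x) := by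
  rw [L2.inner_def]
  refine integral_congr_ae ?_
  filter_upwards [weightedVec_ae hV ha ha', weightedVec_ae hV hb hb'] with x h1 h2
  have h3 : ((√|V x| : ℝ) : ℂ) * ((√|V x| : ℝ) : ℂ) = (|V x| : ℝ) := by
    rw [← Complex.ofReal_mul, Real.mul_self_sqrt (abs_nonneg _)]
  rw [h1, h2, RCLike.inner_apply', map_mul, Complex.conj_ofReal, ← h3]
  ring

theorem norm_weightedVec_le {V : ℝ → ℝ} (hV : Integrable V) {a : ℝ → ℂ}
    (ha : AEStronglyMeasurable a) (hb : ∀ x, ‖a x‖ ≤ 1) {S : Set ℝ} (hS : MeasurableSet S)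
    (has : ∀ x ∉ S, a x = 0) : ‖weightedVec V a‖ ≤ √(∫ x in S, |V x|) := by
  refine Real.le_sqrt_of_sq_le ?_
  rw [L2R.norm_sq_eq_integral, ← integral_indicator hS]
  refine integral_mono_ae ?_ (hV.abs.indicator hS) ?_
  · exact (memLp_two_iff_integrable_sq_norm (Lp.memLp _).1).1 (Lp.memLp _)
  · filter_upwards [weightedVec_ae hV ha hb] with x hx
    rw [hx]
    by_cases h : x ∈ S
    · rw [Set.indicator_of_mem h, norm_mul, mul_pow, Complex.norm_real, Real.norm_eq_abs,
        sq_abs, Real.sq_sqrt (abs_nonneg _)]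
      exact mul_le_of_le_one_right (abs_nonneg _) (pow_le_one₀ (norm_nonneg _) (hb x))
    · rw [Set.indicator_of_notMem h, has x h]
      simp

theorem aestronglyMeasurable_signJ {V : ℝ → ℝ} (hV : Integrable V) :
    AEStronglyMeasurable (fun x => ((signJ V x : ℝ) : ℂ)) := by
  have hφ : Measurable fun t : ℝ => ((if t < 0 then (-1 : ℝ) else 1 : ℝ) : ℂ) :=
    Complex.measurable_ofReal.comp
      (Measurable.ite measurableSet_Iio measurable_const measurable_const)
  exact (hφ.comp_aemeasurable hV.aemeasurable).aestronglyMeasurable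

theorem norm_signJ (V : ℝ → ℝ) (x : ℝ) : ‖((signJ V x : ℝ) : ℂ)‖ = 1 := by
  unfold signJ
  split_ifs <;> simp

/-- A separable expansion of the free Green function gives a nuclear expansion of the
Birman–Schwinger operator. -/
theorem isNuclearSum_birmanSchwinger {N : Type*} [Countable N] {V : ℝ → ℝ} (hV : Integrable V)
    (s : CutSide) (z : ℂ) {c : N → ℂ} {a b : N → ℝ → ℂ}
    (ha : ∀ n, Measurable (a n)) (ha' : ∀ n x, ‖a n x‖ ≤ 1)
    (hb : ∀ n, Measurable (b n)) (hb' : ∀ n x, ‖b n x‖ ≤ 1)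
    (hG : ∀ x y, HasSum (fun n => c n * (a n x * b n y)) (greenFn s z x y))
    (hs : Summable fun n => ‖c n • weightedVec V (a n)‖ *
      ‖weightedVec V fun x => signJ V x * conj (b n x)‖) :
    IsNuclearSum (birmanSchwinger V hV s z) (fun n => c n • weightedVec V (a n))
      (fun n => weightedVec V fun x => signJ V x * conj (b n x)) := by
  set f : N → L2R := fun n => c n • weightedVec V (a n) with hf
  set g : N → L2R := fun n => weightedVec V fun x => signJ V x * conj (b n x) with hg
  have hgm : ∀ n, AEStronglyMeasurable fun x => (signJ V x : ℂ) * conj (b n x) := fun n =>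
    (aestronglyMeasurable_signJ hV).mul
      (Complex.continuous_conj.measurable.comp (hb n)).aestronglyMeasurable
  have hgb : ∀ n x, ‖(signJ V x : ℂ) * conj (b n x)‖ ≤ 1 := fun n x => by
    rw [norm_mul, norm_signJ, one_mul, RCLike.norm_conj]
    exact hb' n x
  have hfae : ∀ n, weightedVec V (a n) =ᵐ[volume] fun x => ((√|V x| : ℝ) : ℂ) * a n x := fun n =>
    weightedVec_ae hV (ha n).aestronglyMeasurable (ha' n)
  have hgae : ∀ n, g n =ᵐ[volume] fun x => ((√|V x| : ℝ) : ℂ) * (signJ V x * conj (b n x)) :=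
    fun n => weightedVec_ae hV (hgm n) (hgb n)
  refine ⟨hs, fun h => ?_⟩
  have hsum : Summable fun n => inner ℂ (g n) h • f n := by
    refine Summable.of_norm_bounded (hs.mul_right ‖h‖) fun n => ?_
    rw [norm_smul]
    calc ‖inner ℂ (g n) h‖ * ‖f n‖ ≤ (‖g n‖ * ‖h‖) * ‖f n‖ :=
          mul_le_mul_of_nonneg_right (norm_inner_le_norm _ _) (norm_nonneg _)
      _ = ‖f n‖ * ‖g n‖ * ‖h‖ := by ring
  suffices hval : ∑' n, inner ℂ (g n) h • f n = birmanSchwinger V hV s z h by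
    rw [← hval]
    exact hsum.hasSum
  -- Tested against `u`, the identity becomes an exchange of the sum over `n` with a double
  -- integral, justified by `∑ₙ ∫ ‖Φ n‖ < ∞`.
  refine ext_inner_left ℂ fun u => ?_
  have h1 : HasSum (fun n => inner ℂ u (f n) * inner ℂ (g n) h)
      (inner ℂ u (∑' n, inner ℂ (g n) h • f n)) := by
    have := (innerSL ℂ u).hasSum hsum.hasSum
    simpa [inner_smul_right, mul_comm] using this
  refine h1.unique ?_
  let p : N → ℝ → ℂ := fun n x => conj (u x) * (((√|V x| : ℝ) : ℂ) * a n x)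
  let q : N → ℝ → ℂ := fun n y => b n y * (((√|V y| * signJ V y : ℝ) : ℂ) * h y)
  have hpint : ∀ n, inner ℂ u (weightedVec V (a n)) = ∫ x, p n x := fun n => by
    rw [L2.inner_def]
    refine integral_congr_ae ?_
    filter_upwards [hfae n] with x hx
    rw [hx, RCLike.inner_apply']
  have hqint : ∀ n, inner ℂ (g n) h = ∫ y, q n y := fun n => by
    rw [L2.inner_def]
    refine integral_congr_ae ?_
    filter_upwards [hgae n] with x hx
    rw [hx, RCLike.inner_apply']
    simp only [map_mul, Complex.conj_ofReal, Complex.conj_conj, q, Complex.ofReal_mul]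
    ring
  have hpI : ∀ n, Integrable (p n) := fun n => by
    refine (L2.integrable_inner u (weightedVec V (a n))).congr ?_
    filter_upwards [hfae n] with x hx
    rw [hx, RCLike.inner_apply']
  have hqI : ∀ n, Integrable (q n) := fun n => by
    refine (integrable_sqrtAbs_mul_signJ_mul hV h).bdd_mul (c := 1)
      (hb n).aestronglyMeasurable (ae_of_all _ fun y => hb' n y)
  have hpn : ∀ n, ∫ x, ‖p n x‖ ≤ ‖u‖ * ‖weightedVec V (a n)‖ := fun n => by
    refine le_trans (le_of_eq (integral_congr_ae ?_))
      (integral_norm_mul_norm_le u (weightedVec V (a n)))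
    filter_upwards [hfae n] with x hx
    rw [hx, norm_mul, RCLike.norm_conj]
  have hqn : ∀ n, ∫ x, ‖q n x‖ ≤ ‖g n‖ * ‖h‖ := fun n => by
    refine le_trans (le_of_eq (integral_congr_ae ?_)) (integral_norm_mul_norm_le (g n) h)
    filter_upwards [hgae n] with x hx
    rw [hx]
    simp only [norm_mul, RCLike.norm_conj, norm_signJ, q, Complex.ofReal_mul]
    ring
  let Φ : N → ℝ × ℝ → ℂ := fun n w => c n * (p n w.1 * q n w.2)
  have hΦI : ∀ n, Integrable (Φ n) := fun n => ((hpI n).mul_prod (hqI n)).const_mul (c n)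
  have hΦn : ∀ n, ∫ w, ‖Φ n w‖ ≤ ‖u‖ * ‖h‖ * (‖f n‖ * ‖g n‖) := fun n => by
    have h2 : ∫ w, ‖Φ n w‖ = ‖c n‖ * ((∫ x, ‖p n x‖) * ∫ y, ‖q n y‖) := by
      rw [← integral_prod_mul, ← integral_const_mul]
      simp only [Φ, norm_mul]
      rfl
    rw [h2, hf, norm_smul]
    calc ‖c n‖ * ((∫ x, ‖p n x‖) * ∫ y, ‖q n y‖)
        ≤ ‖c n‖ * ((‖u‖ * ‖weightedVec V (a n)‖) * (‖g n‖ * ‖h‖)) := by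
          refine mul_le_mul_of_nonneg_left ?_ (norm_nonneg _)
          exact mul_le_mul (hpn n) (hqn n) (integral_nonneg fun _ => norm_nonneg _) (by positivity)
      _ = _ := by ring
  have h3 := hasSum_integral_of_summable_integral_norm hΦI
    (Summable.of_nonneg_of_le (fun n => integral_nonneg fun _ => norm_nonneg _) hΦn
      (hs.mul_left (‖u‖ * ‖h‖)))
  have h4 : ∀ n, ∫ w, Φ n w = inner ℂ u (f n) * inner ℂ (g n) h := fun n => by
    rw [hf, inner_smul_right, hpint, hqint, mul_assoc, ← integral_prod_mul, ← integral_const_mul]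
    rfl
  simp only [h4] at h3
  let p₀ : ℝ → ℂ := fun x => conj (u x) * ((√|V x| : ℝ) : ℂ)
  let q₀ : ℝ → ℂ := fun y => ((√|V y| * signJ V y : ℝ) : ℂ) * h y
  have h5 : ∀ w, ∑' n, Φ n w = greenFn s z w.1 w.2 * (p₀ w.1 * q₀ w.2) := fun w => by
    rw [← ((hG w.1 w.2).mul_right (p₀ w.1 * q₀ w.2)).tsum_eq]
    refine tsum_congr fun n => ?_
    simp only [Φ, p, q, p₀, q₀]
    ring
  have hp₀ : Integrable p₀ := by
    have := (Lp.memLp u).star.integrable_mul (memLp_sqrtAbs hV)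
    exact this
  have hI : Integrable fun w : ℝ × ℝ => greenFn s z w.1 w.2 * (p₀ w.1 * q₀ w.2) :=
    (hp₀.mul_prod (integrable_sqrtAbs_mul_signJ_mul hV h)).bdd_mul
      (continuous_greenFn s z).aestronglyMeasurable
      (ae_of_all _ fun w => norm_greenFn_le s z w.1 w.2)
  rw [integral_congr_ae (ae_of_all _ h5), Measure.volume_eq_prod, integral_prod _ hI] at h3
  have h6 : inner ℂ u (birmanSchwinger V hV s z h) =
      ∫ x, ∫ y, greenFn s z x y * (p₀ x * q₀ y) := by
    rw [L2.inner_def]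
    refine integral_congr_ae ?_
    filter_upwards [birmanSchwinger_ae hV s z h] with x hx
    rw [hx, RCLike.inner_apply', integral_bsKernel_mul, ← mul_assoc, ← integral_const_mul]
    refine integral_congr_ae (ae_of_all _ fun y => ?_)
    simp only [p₀, q₀]
    ring
  rw [h6]
  exact h3

end WeightedVec

/-! ### The Fourier expansion of `exp (i κ |t|)` on `(-1, 1)` -/

section Cosine

open Complex in
/-- The cosine coefficients of `t ↦ exp (i κ t)` on `[0, 1]`. -/
noncomputable def cosCoeff (κ : ℂ) (n : ℤ) : ℂ :=
  ∫ t in (0 : ℝ)..1, exp (I * κ * t) * (Real.cos (Real.pi * n * t) : ℝ)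

theorem norm_exp_I_mul_le_one {κ : ℂ} (hκ : 0 ≤ κ.im) {t : ℝ} (ht : 0 ≤ t) :
    ‖Complex.exp (Complex.I * κ * t)‖ ≤ 1 := by
  rw [Complex.norm_exp, Real.exp_le_one_iff]
  simp only [Complex.mul_re, Complex.I_re, Complex.I_im, Complex.mul_im, Complex.ofReal_re,
    Complex.ofReal_im]
  nlinarith [mul_nonneg hκ ht]

theorem norm_cosCoeff_le_one {κ : ℂ} (hκ : 0 ≤ κ.im) (n : ℤ) : ‖cosCoeff κ n‖ ≤ 1 := by
  have h := intervalIntegral.norm_integral_le_of_norm_le_const (a := 0) (b := 1) (C := 1)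
    (f := fun t : ℝ => Complex.exp (Complex.I * κ * t) * (Real.cos (Real.pi * n * t) : ℝ))
    fun t ht => by
      rw [Set.uIoc_of_le zero_le_one] at ht
      rw [norm_mul, Complex.norm_real]
      exact mul_le_one₀ (norm_exp_I_mul_le_one hκ ht.1.le) (norm_nonneg _)
        (Real.abs_cos_le_one _)
  rwa [sub_zero, abs_one, mul_one] at h

/-- Two integrations by parts, condensed into one explicit antiderivative; its sine part vanishes at
both ends since `n` is an integer. The factor stays on the left because it is zero at the resonances
`κ = ±πn`. -/
theorem cosCoeff_mul_eq (κ : ℂ) {n : ℤ} (hn : n ≠ 0) :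
    cosCoeff κ n * (1 - κ ^ 2 / (Real.pi * n) ^ 2) =
      Complex.I * κ * (Complex.exp (Complex.I * κ) * (Real.cos (Real.pi * n) : ℝ) - 1) /
        (Real.pi * n) ^ 2 := by
  have hm : (Real.pi * n : ℂ) ≠ 0 :=
    mul_ne_zero (Complex.ofReal_ne_zero.2 Real.pi_ne_zero) (Int.cast_ne_zero.2 hn)
  have hsin : Real.sin (Real.pi * n) = 0 := by rw [mul_comm]; exact Real.sin_int_mul_pi n
  have hderiv : ∀ t ∈ Set.uIcc (0 : ℝ) 1, HasDerivAt (fun t : ℝ => Complex.exp (Complex.I * κ * t) *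
      ((Real.sin (Real.pi * n * t) : ℝ) / (Real.pi * n) +
        Complex.I * κ * (Real.cos (Real.pi * n * t) : ℝ) / (Real.pi * n) ^ 2))
      (Complex.exp (Complex.I * κ * t) * (Real.cos (Real.pi * n * t) : ℝ) *
        (1 - κ ^ 2 / (Real.pi * n) ^ 2)) t := by
    intro t _
    have hlin : HasDerivAt (fun t : ℝ => Real.pi * n * t) (Real.pi * n) t := by
      simpa using (hasDerivAt_id t).const_mul (Real.pi * n)
    have h1 : HasDerivAt (fun t : ℝ => Complex.exp (Complex.I * κ * t))
        (Complex.exp (Complex.I * κ * t) * (Complex.I * κ)) t := by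
      have h0 : HasDerivAt (fun t : ℝ => Complex.I * κ * (t : ℂ)) (Complex.I * κ) t := by
        simpa using (Complex.ofRealCLM.hasDerivAt (x := t)).const_mul (Complex.I * κ)
      exact h0.cexp
    have h2 := hlin.sin.ofReal_comp
    have h3 := hlin.cos.ofReal_comp
    have h4 := h1.mul ((h2.div_const (Real.pi * n : ℂ)).add
      ((h3.const_mul (Complex.I * κ)).div_const ((Real.pi * n : ℂ) ^ 2)))
    refine h4.congr_deriv ?_
    simp only [Pi.add_apply]
    push_cast
    field_simp
    linear_combination (κ ^ 2 * Complex.cos (t * Real.pi * n)) * Complex.I_sq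
  have hint : IntervalIntegrable (fun t : ℝ => Complex.exp (Complex.I * κ * t) *
      (Real.cos (Real.pi * n * t) : ℝ) * (1 - κ ^ 2 / (Real.pi * n) ^ 2)) volume 0 1 := by
    refine Continuous.intervalIntegrable ?_ _ _
    fun_prop
  rw [cosCoeff, ← intervalIntegral.integral_mul_const,
    intervalIntegral.integral_eq_sub_of_hasDerivAt hderiv hint]
  simp only [mul_one, hsin, Complex.ofReal_one, mul_zero, Real.sin_zero, Real.cos_zero,
    Complex.ofReal_zero, Complex.exp_zero]
  field_simp
  ring

/-- A summable bound for the cosine coefficients, uniform for `‖κ‖ ≤ R`. -/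
noncomputable def cosBound (R : ℝ) (n : ℤ) : ℝ :=
  (if n = 0 then 1 else 0) + (2 * R + R ^ 2) * (1 / (n : ℝ) ^ 2)

theorem summable_cosBound (R : ℝ) : Summable (cosBound R) := by
  refine Summable.add ?_ ((Real.summable_one_div_int_pow.2 one_lt_two).mul_left _)
  exact summable_of_hasFiniteSupport ((Set.finite_singleton (0 : ℤ)).subset fun n hn => by
    by_contra h
    simp_all)

theorem cosBound_nonneg {R : ℝ} (hR : 0 ≤ R) (n : ℤ) : 0 ≤ cosBound R n := by
  unfold cosBound
  split_ifs <;> positivity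

theorem norm_cosCoeff_le {κ : ℂ} (hκ : 0 ≤ κ.im) {R : ℝ} (hR : ‖κ‖ ≤ R) (n : ℤ) :
    ‖cosCoeff κ n‖ ≤ cosBound R n := by
  have h1 := norm_cosCoeff_le_one hκ n
  have hR0 : 0 ≤ R := (norm_nonneg _).trans hR
  by_cases hn : n = 0
  · have : 0 ≤ (2 * R + R ^ 2) * (1 / (n : ℝ) ^ 2) := by positivity
    -- At `n = 0` the quotient `1 / n ^ 2` has the default value `0`; the indicator in `cosBound`
    -- carries this term.
    simp only [cosBound, if_pos hn]
    linarith
  have hn1 : (1 : ℝ) ≤ (n : ℝ) ^ 2 := by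
    have : (1 : ℤ) ≤ n ^ 2 := by have := sq_pos_of_ne_zero (R := ℤ) hn; omega
    exact_mod_cast this
  have hc : ‖(Real.pi * n : ℂ) ^ 2‖ = Real.pi ^ 2 * (n : ℝ) ^ 2 := by
    rw [norm_pow, norm_mul, Complex.norm_real, Complex.norm_intCast, mul_pow, Real.norm_eq_abs,
      sq_abs, sq_abs]
  have hpi : (n : ℝ) ^ 2 ≤ Real.pi ^ 2 * (n : ℝ) ^ 2 := by
    refine le_mul_of_one_le_left (by positivity) (one_le_pow₀ ?_)
    linarith [Real.pi_gt_three]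
  -- The resonant term is moved to the right and estimated by the trivial bound `‖cosCoeff κ n‖ ≤
  -- 1`. No division by `1 - κ²/(πn)²` occurs, so the bound is uniform in `κ`.
  have h2 : cosCoeff κ n = Complex.I * κ * (Complex.exp (Complex.I * κ) *
      (Real.cos (Real.pi * n) : ℝ) - 1) / (Real.pi * n) ^ 2 +
        cosCoeff κ n * κ ^ 2 / (Real.pi * n) ^ 2 := by
    rw [← cosCoeff_mul_eq κ hn]
    ring
  have h3 : ‖Complex.exp (Complex.I * κ) * (Real.cos (Real.pi * n) : ℝ) - 1‖ ≤ 2 := by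
    refine (norm_sub_le _ _).trans ?_
    rw [norm_mul, Complex.norm_real, norm_one]
    have h4 : ‖Complex.exp (Complex.I * κ)‖ ≤ 1 := by
      simpa using norm_exp_I_mul_le_one hκ (zero_le_one (α := ℝ))
    have h5 := mul_le_one₀ h4 (abs_nonneg _) (Real.abs_cos_le_one (Real.pi * n))
    rw [Real.norm_eq_abs]
    linarith
  simp only [cosBound, if_neg hn, zero_add]
  calc ‖cosCoeff κ n‖
      ≤ ‖κ‖ * 2 / (Real.pi ^ 2 * (n : ℝ) ^ 2) + 1 * ‖κ‖ ^ 2 / (Real.pi ^ 2 * (n : ℝ) ^ 2) := by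
        rw [h2]
        refine (norm_add_le _ _).trans ?_
        rw [norm_div, norm_div, hc, norm_mul, norm_mul, norm_mul, Complex.norm_I, one_mul, norm_pow]
        gcongr
    _ = (2 * ‖κ‖ + ‖κ‖ ^ 2) / (Real.pi ^ 2 * (n : ℝ) ^ 2) := by ring
    _ ≤ (2 * R + R ^ 2) / (n : ℝ) ^ 2 := by gcongr
    _ = _ := by ring

theorem continuous_cosCoeff (n : ℤ) : Continuous fun κ => cosCoeff κ n := by
  refine intervalIntegral.continuous_parametric_intervalIntegral_of_continuous' ?_ 0 1
  simp only [Function.uncurry_def]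
  fun_prop

/-- The even function `exp(iκ|t|)` on `[-1, 1]` extends continuously with period `2`. Its Fourier
coefficients are the `cosCoeff κ n`, and their summability gives pointwise convergence. -/
theorem hasSum_cosCoeff {κ : ℂ} (hκ : 0 ≤ κ.im) {t : ℝ} (ht : |t| < 1) :
    HasSum (fun n : ℤ => cosCoeff κ n * Complex.exp (Complex.I * (Real.pi * n * t)))
      (Complex.exp (Complex.I * κ * |t|)) := by
  let φ : ℝ → ℂ := fun t => Complex.exp (Complex.I * κ * |t|)
  have hφc : Continuous φ := by fun_prop
  have : Fact (0 < (2 : ℝ)) := ⟨two_pos⟩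
  let F : C(AddCircle (2 : ℝ), ℂ) := ⟨AddCircle.liftIco 2 (-1) φ,
    AddCircle.liftIco_continuous (by norm_num [φ]) hφc.continuousOn⟩
  have hcoef : ∀ n, fourierCoeff F n = cosCoeff κ n := by
    intro n
    change fourierCoeff (AddCircle.liftIco 2 (-1) φ) n = _
    rw [fourierCoeff_eq_intervalIntegral _ n (-1)]
    have e1 : ∫ x in (-1 : ℝ)..(-1) + 2, (fourier (-n) (x : AddCircle (2 : ℝ))) •
        AddCircle.liftIco 2 (-1) φ x =
        ∫ x in (-1 : ℝ)..1, Complex.exp (-(Complex.I * (Real.pi * n * x))) * φ x := by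
      rw [show (-1 : ℝ) + 2 = 1 by norm_num]
      refine intervalIntegral.integral_congr_Ioo_of_le (by norm_num) fun x hx => ?_
      rw [AddCircle.liftIco_coe_apply ⟨hx.1.le, by have := hx.2; linarith⟩, fourier_coe_apply,
        smul_eq_mul]
      congr 2
      push_cast
      ring
    have hcont : Continuous fun x : ℝ =>
        Complex.exp (-(Complex.I * (Real.pi * n * x))) * φ x := by fun_prop
    rw [e1, ← intervalIntegral.integral_add_adjacent_intervals (b := 0)
      (hcont.intervalIntegrable _ _) (hcont.intervalIntegrable _ _)]
    -- Evenness of `φ` folds the left half onto `[0, 1]`, where the two exponentials add up to a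
    -- cosine.
    have e2 : ∫ x in (-1 : ℝ)..0, Complex.exp (-(Complex.I * (Real.pi * n * x))) * φ x =
        ∫ x in (0 : ℝ)..1, Complex.exp (Complex.I * (Real.pi * n * x)) * φ x := by
      have := intervalIntegral.integral_comp_neg (a := 0) (b := 1) fun x : ℝ =>
        Complex.exp (-(Complex.I * (Real.pi * n * x))) * φ x
      rw [neg_zero] at this
      rw [← this]
      refine intervalIntegral.integral_congr fun x _ => ?_
      simp [φ]
    rw [e2, ← intervalIntegral.integral_add
      (Continuous.intervalIntegrable (by fun_prop) _ _) (hcont.intervalIntegrable _ _), cosCoeff,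
      ← intervalIntegral.integral_smul]
    refine intervalIntegral.integral_congr fun x hx => ?_
    rw [Set.uIcc_of_le zero_le_one] at hx
    have hcos : Complex.exp (Complex.I * (Real.pi * n * x)) +
        Complex.exp (-(Complex.I * (Real.pi * n * x))) =
        2 * (Real.cos (Real.pi * n * x) : ℝ) := by
      rw [Complex.ofReal_cos, Complex.two_cos]
      push_cast
      congr 2 <;> ring
    simp only [φ, abs_of_nonneg hx.1]
    rw [← add_mul, hcos, Complex.real_smul]
    push_cast
    ring
  have hsum : Summable (fourierCoeff F) := by
    simp only [funext hcoef]
    exact Summable.of_norm_bounded (summable_cosBound ‖κ‖) fun n => norm_cosCoeff_le hκ le_rfl n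
  have h := has_pointwise_sum_fourier_series_of_summable hsum (t : AddCircle (2 : ℝ))
  have hFt : F (t : AddCircle (2 : ℝ)) = φ t := by
    change AddCircle.liftIco 2 (-1) φ t = φ t
    refine AddCircle.liftIco_coe_apply ⟨?_, ?_⟩
    · linarith [(abs_lt.1 ht).1]
    · linarith [(abs_lt.1 ht).2]
  rw [hFt] at h
  refine h.congr_fun fun n => ?_
  rw [hcoef, fourier_coe_apply, smul_eq_mul]
  congr 2
  push_cast
  ring

end Cosine

/-! ### The wave number -/

section WaveNumber

open Classical in
/-- The square root `κ` of `z` with `Im κ ≥ 0` for which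
`R_∞(z; x, y) = -i / (2 κ) exp (i κ |x - y|)` on the side `s` of the cut. -/
noncomputable def waveNumber (s : CutSide) (z : ℂ) : ℂ :=
  if 0 < (Complex.sqrt z).im ∨ ((Complex.sqrt z).im = 0 ∧ s = CutSide.upper) then
    Complex.sqrt z else -Complex.sqrt z

theorem waveNumber_sq (s : CutSide) (z : ℂ) : waveNumber s z ^ 2 = z := by
  have h : Complex.sqrt z ^ 2 = z := by
    simp [Complex.sqrt]
  unfold waveNumber
  split_ifs
  · exact h
  · rw [neg_sq, h]

theorem waveNumber_im_nonneg (s : CutSide) (z : ℂ) : 0 ≤ (waveNumber s z).im := by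
  unfold waveNumber
  split_ifs with h
  · rcases h with h | h
    · exact h.le
    · exact h.1.ge
  · rw [Complex.neg_im, neg_nonneg]
    exact not_lt.1 fun h' => h (Or.inl h')

theorem greenFn_eq (s : CutSide) (z : ℂ) (x y : ℝ) :
    greenFn s z x y = -(Complex.I / (2 * waveNumber s z)) *
      Complex.exp (Complex.I * waveNumber s z * |x - y|) := by
  unfold greenFn waveNumber
  split_ifs
  · rfl
  · congr 1
    · rw [mul_neg, div_neg, neg_neg]
    · congr 1
      ring

end WaveNumber

/-! ### The block expansion of the kernel -/

section Blocks

open Complex ComplexConjugate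

/-- The indices of the block expansion: `inl (j, l)` stands for the rank one block
`[j, j + 1) × [l, l + 1)` with `j ≠ l`, and `inr (j, n)` for the `n`-th Fourier mode on
the diagonal block `[j, j + 1) × [j, j + 1)`. -/
abbrev BlockIndex : Type := (ℤ × ℤ) ⊕ (ℤ × ℤ)

/-- The factors of the block expansion that depend on the first variable. -/
noncomputable def blockLeft (κ : ℂ) : BlockIndex → ℝ → ℂ
  | .inl (j, l) => (Set.Ico (j : ℝ) (j + 1)).indicator fun x =>
      if l < j then exp (I * κ * (x - j : ℝ)) else exp (I * κ * (j + 1 - x : ℝ))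
  | .inr (j, n) => (Set.Ico (j : ℝ) (j + 1)).indicator fun x => exp ((Real.pi * n * x : ℝ) * I)

/-- The factors of the block expansion that depend on the second variable. -/
noncomputable def blockRight (κ : ℂ) : BlockIndex → ℝ → ℂ
  | .inl (j, l) => (Set.Ico (l : ℝ) (l + 1)).indicator fun y =>
      if l < j then exp (I * κ * (l + 1 - y : ℝ)) else exp (I * κ * (y - l : ℝ))
  | .inr (j, n) => (Set.Ico (j : ℝ) (j + 1)).indicator fun y => exp ((-(Real.pi * n * y) : ℝ) * I)

/-- The coefficients of the block expansion of `exp (i κ |x - y|)`. -/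
noncomputable def blockCoeff (κ : ℂ) : BlockIndex → ℂ
  | .inl (j, l) => if j = l then 0 else exp (I * κ * (|(j : ℝ) - l| - 1 : ℝ))
  | .inr (_, n) => cosCoeff κ n

theorem measurable_blockLeft (κ : ℂ) (n : BlockIndex) : Measurable (blockLeft κ n) := by
  rcases n with ⟨j, l⟩ | ⟨j, n⟩
  · refine Measurable.indicator ?_ measurableSet_Ico
    split_ifs <;> fun_prop
  · refine Measurable.indicator ?_ measurableSet_Ico
    fun_prop

theorem measurable_blockRight (κ : ℂ) (n : BlockIndex) : Measurable (blockRight κ n) := by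
  rcases n with ⟨j, l⟩ | ⟨j, n⟩
  · refine Measurable.indicator ?_ measurableSet_Ico
    split_ifs <;> fun_prop
  · refine Measurable.indicator ?_ measurableSet_Ico
    fun_prop

theorem norm_blockLeft_le {κ : ℂ} (hκ : 0 ≤ κ.im) (n : BlockIndex) (x : ℝ) :
    ‖blockLeft κ n x‖ ≤ 1 := by
  rcases n with ⟨j, l⟩ | ⟨j, n⟩
  · by_cases hx : x ∈ Set.Ico (j : ℝ) (j + 1)
    · rw [blockLeft, Set.indicator_of_mem hx]
      split_ifs
      · exact norm_exp_I_mul_le_one hκ (by linarith [hx.1])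
      · exact norm_exp_I_mul_le_one hκ (by linarith [hx.2])
    · rw [blockLeft, Set.indicator_of_notMem hx]
      simp
  · by_cases hx : x ∈ Set.Ico (j : ℝ) (j + 1)
    · rw [blockLeft, Set.indicator_of_mem hx, norm_exp_ofReal_mul_I]
    · rw [blockLeft, Set.indicator_of_notMem hx]
      simp

theorem norm_blockRight_le {κ : ℂ} (hκ : 0 ≤ κ.im) (n : BlockIndex) (x : ℝ) :
    ‖blockRight κ n x‖ ≤ 1 := by
  rcases n with ⟨j, l⟩ | ⟨j, n⟩
  · by_cases hx : x ∈ Set.Ico (l : ℝ) (l + 1)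
    · rw [blockRight, Set.indicator_of_mem hx]
      split_ifs
      · exact norm_exp_I_mul_le_one hκ (by linarith [hx.2])
      · exact norm_exp_I_mul_le_one hκ (by linarith [hx.1])
    · rw [blockRight, Set.indicator_of_notMem hx]
      simp
  · by_cases hx : x ∈ Set.Ico (j : ℝ) (j + 1)
    · rw [blockRight, Set.indicator_of_mem hx, norm_exp_ofReal_mul_I]
    · rw [blockRight, Set.indicator_of_notMem hx]
      simp

/-- The half-open cells leave exactly one block for each `(x, y)`. If the cells differ, `|x - y|` is
the sum of the distances of `x` and `y` to the facing ends of their cells and of the gap `|j - l| -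
1`; all three are nonnegative, so every factor has modulus at most one. If they agree, `|x - y| < 1`
and the Fourier series applies. -/
theorem hasSum_block {κ : ℂ} (hκ : 0 ≤ κ.im) (x y : ℝ) :
    HasSum (fun n => blockCoeff κ n * (blockLeft κ n x * blockRight κ n y))
      (exp (I * κ * |x - y|)) := by
  have hmem : ∀ (t : ℝ) (j : ℤ), t ∈ Set.Ico (j : ℝ) (j + 1) ↔ j = ⌊t⌋ := fun t j => by
    rw [eq_comm, Int.floor_eq_iff, Set.mem_Ico]
  have hx := (hmem x _).2 rfl
  have hy := (hmem y _).2 rfl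
  set p := ⌊x⌋
  set q := ⌊y⌋
  have h1 : HasSum ((fun n => blockCoeff κ n * (blockLeft κ n x * blockRight κ n y)) ∘ Sum.inl)
      (if p = q then 0 else exp (I * κ * |x - y|)) := by
    have hval : ((fun n => blockCoeff κ n * (blockLeft κ n x * blockRight κ n y)) ∘ Sum.inl)
        (p, q) = if p = q then 0 else exp (I * κ * |x - y|) := by
      simp only [Function.comp_apply, blockCoeff, blockLeft, blockRight,
        Set.indicator_of_mem hx, Set.indicator_of_mem hy]
      split_ifs with hpq hlt hlt
      · rw [zero_mul]
      · rw [zero_mul]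
      · have h3 : (q : ℝ) + 1 ≤ p := by exact_mod_cast hlt
        rw [← exp_add, ← exp_add, abs_of_nonneg (by linarith : (0 : ℝ) ≤ p - q),
          abs_of_nonneg (by linarith [hx.1, hy.2] : 0 ≤ x - y)]
        congr 1
        push_cast
        ring
      · have h3 : (p : ℝ) + 1 ≤ q := by
          have : p < q := lt_of_le_of_ne (not_lt.1 hlt) hpq
          exact_mod_cast this
        rw [← exp_add, ← exp_add, abs_of_nonpos (by linarith : (p : ℝ) - q ≤ 0),
          abs_of_nonpos (by linarith [hy.1, hx.2] : x - y ≤ 0)]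
        congr 1
        push_cast
        ring
    rw [← hval]
    refine hasSum_single _ fun ⟨j, l⟩ hjl => ?_
    simp only [Function.comp_apply, blockLeft, blockRight]
    by_cases hj : j = p
    · have hl : l ≠ q := fun h => hjl (by rw [hj, h])
      rw [Set.indicator_of_notMem (s := Set.Ico (l : ℝ) (l + 1)) (mt (hmem y l).1 hl), mul_zero,
        mul_zero]
    · rw [Set.indicator_of_notMem (s := Set.Ico (j : ℝ) (j + 1)) (mt (hmem x j).1 hj), zero_mul,
        mul_zero]
  have h2 : HasSum ((fun n => blockCoeff κ n * (blockLeft κ n x * blockRight κ n y)) ∘ Sum.inr)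
      (if p = q then exp (I * κ * |x - y|) else 0) := by
    split_ifs with hpq
    · have hinj : Function.Injective fun n : ℤ => (p, n) := fun m n h => (Prod.mk.inj h).2
      rw [← hinj.hasSum_iff]
      · have hyp : y ∈ Set.Ico (p : ℝ) (p + 1) := hpq ▸ hy
        have hlt : |x - y| < 1 := by
          rw [abs_lt]
          constructor <;> linarith [hx.1, hx.2, hyp.1, hyp.2]
        refine (hasSum_cosCoeff hκ hlt).congr_fun fun n => ?_
        simp only [Function.comp_apply, blockCoeff, blockLeft, blockRight,
          Set.indicator_of_mem hx, Set.indicator_of_mem hyp]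
        rw [← exp_add]
        congr 2
        push_cast
        ring
      · rintro ⟨j, n⟩ hj
        have hj' : j ≠ p := fun h => hj ⟨n, by rw [h]⟩
        simp only [Function.comp_apply, blockLeft, blockRight]
        rw [Set.indicator_of_notMem (s := Set.Ico (j : ℝ) (j + 1)) (mt (hmem x j).1 hj'), zero_mul,
          mul_zero]
    · convert hasSum_zero using 1
      ext ⟨j, n⟩
      simp only [Function.comp_apply, blockLeft, blockRight]
      by_cases hj : j = p
      · have hl : j ≠ q := fun h => hpq (hj ▸ h)
        rw [Set.indicator_of_notMem (a := y) (mt (hmem y j).1 hl), mul_zero, mul_zero]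
      · rw [Set.indicator_of_notMem (a := x) (mt (hmem x j).1 hj), zero_mul, mul_zero]
  have h := h1.sum h2
  split_ifs at h with hpq
  · simpa using h
  · simpa using h

end Blocks

/-! ### Summability of the block expansion -/

section Summability

open Complex ComplexConjugate

/-- The mass `∫ |V|` of the unit interval `[j, j + 1]`. -/
noncomputable def cellMass (V : ℝ → ℝ) (j : ℤ) : ℝ := ∫ x in Set.Icc (j : ℝ) (j + 1), |V x|

theorem cellMass_nonneg (V : ℝ → ℝ) (j : ℤ) : 0 ≤ cellMass V j :=
  integral_nonneg fun _ => abs_nonneg _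

theorem summable_cellMass {V : ℝ → ℝ} (hV : Integrable V) : Summable (cellMass V) := by
  have h := (hasSum_integral_iUnion (μ := volume) (f := fun x => |V x|)
    (s := fun j : ℤ => Set.Ico (j : ℝ) (j + 1)) (fun _ => measurableSet_Ico)
    (Set.pairwise_disjoint_Ico_intCast ℝ) hV.abs.integrableOn).summable
  refine h.congr fun j => ?_
  rw [cellMass, integral_Icc_eq_integral_Ico]

theorem MemBirmanSolomyak.summable_sqrt_cellMass {V : ℝ → ℝ} (h : MemBirmanSolomyak (1 / 2) V) :
    Summable fun j => √(cellMass V j) := by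
  simpa only [cellMass, Real.sqrt_eq_rpow] using h.2

theorem norm_weightedVec_blockLeft_le {V : ℝ → ℝ} (hV : Integrable V) {κ : ℂ} (hκ : 0 ≤ κ.im) :
    ∀ n, ‖weightedVec V (blockLeft κ n)‖ ≤
      √(cellMass V (Sum.elim Prod.fst Prod.fst n)) := by
  intro n
  refine norm_weightedVec_le hV (measurable_blockLeft κ n).aestronglyMeasurable
    (norm_blockLeft_le hκ n) measurableSet_Icc fun x hx => ?_
  rcases n with ⟨j, l⟩ | ⟨j, n⟩ <;>
  · rw [blockLeft]
    exact Set.indicator_of_notMem (fun h => hx (Set.Ico_subset_Icc_self h)) _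

theorem aestronglyMeasurable_signJ_mul_blockRight {V : ℝ → ℝ} (hV : Integrable V) (κ : ℂ)
    (n : BlockIndex) : AEStronglyMeasurable fun x => (signJ V x : ℂ) * conj (blockRight κ n x) :=
  (aestronglyMeasurable_signJ hV).mul
    (continuous_conj.measurable.comp (measurable_blockRight κ n)).aestronglyMeasurable

theorem norm_signJ_mul_blockRight_le (V : ℝ → ℝ) {κ : ℂ} (hκ : 0 ≤ κ.im) (n : BlockIndex) (x : ℝ) :
    ‖(signJ V x : ℂ) * conj (blockRight κ n x)‖ ≤ 1 := by
  rw [norm_mul, norm_signJ, one_mul, RCLike.norm_conj]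
  exact norm_blockRight_le hκ n x

theorem norm_weightedVec_blockRight_le {V : ℝ → ℝ} (hV : Integrable V) {κ : ℂ} (hκ : 0 ≤ κ.im) :
    ∀ n, ‖weightedVec V fun x => signJ V x * conj (blockRight κ n x)‖ ≤
      √(cellMass V (Sum.elim Prod.snd Prod.fst n)) := by
  intro n
  refine norm_weightedVec_le hV (aestronglyMeasurable_signJ_mul_blockRight hV κ n)
    (norm_signJ_mul_blockRight_le V hκ n) measurableSet_Icc fun x hx => ?_
  have : blockRight κ n x = 0 := by
    rcases n with ⟨j, l⟩ | ⟨j, n⟩ <;>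
    · rw [blockRight]
      exact Set.indicator_of_notMem (fun h => hx (Set.Ico_subset_Icc_self h)) _
  rw [this, map_zero, mul_zero]

/-- The vectors of the nuclear expansion of the Birman–Schwinger operator, ranges. -/
noncomputable def bsLeft (V : ℝ → ℝ) (κ : ℂ) (n : BlockIndex) : L2R :=
  (-(I / (2 * κ)) * blockCoeff κ n) • weightedVec V (blockLeft κ n)

/-- The vectors of the nuclear expansion of the Birman–Schwinger operator, functionals. -/
noncomputable def bsRight (V : ℝ → ℝ) (κ : ℂ) (n : BlockIndex) : L2R :=
  weightedVec V fun x => signJ V x * conj (blockRight κ n x)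

/-- A bound for the terms of the nuclear expansion: `m` bounds `1 / (2 |κ|)`, `w` bounds the
coefficients of the off-diagonal blocks and `R` bounds `|κ|`. -/
noncomputable def bsBound (V : ℝ → ℝ) (m R : ℝ) (w : ℤ × ℤ → ℝ) : BlockIndex → ℝ
  | .inl p => m * (w p * (√(cellMass V p.1) * √(cellMass V p.2)))
  | .inr p => m * (cellMass V p.1 * cosBound R p.2)

theorem norm_bsLeft_mul_norm_bsRight_le {V : ℝ → ℝ} (hV : Integrable V) {κ : ℂ} (hκ : 0 ≤ κ.im)
    {m R : ℝ} {w : ℤ × ℤ → ℝ} (hm : ‖I / (2 * κ)‖ ≤ m) (hR : ‖κ‖ ≤ R)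
    (hw : ∀ p, ‖blockCoeff κ (.inl p)‖ ≤ w p) (n : BlockIndex) :
    ‖bsLeft V κ n‖ * ‖bsRight V κ n‖ ≤ bsBound V m R w n := by
  have h1 := norm_weightedVec_blockLeft_le hV hκ n
  have h2 := norm_weightedVec_blockRight_le hV hκ n
  have hm0 : 0 ≤ m := (norm_nonneg _).trans hm
  rw [bsLeft, bsRight, norm_smul, norm_mul, norm_neg, mul_assoc, mul_assoc]
  rcases n with p | p
  · exact mul_le_mul hm (mul_le_mul (hw p) (mul_le_mul h1 h2 (norm_nonneg _) (Real.sqrt_nonneg _))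
      (by positivity) ((norm_nonneg _).trans (hw p))) (by positivity) hm0
  · rw [bsBound, mul_comm (cellMass V p.1)]
    have h3 := mul_le_mul h1 h2 (norm_nonneg _) (Real.sqrt_nonneg _)
    rw [Sum.elim_inr, Sum.elim_inr, Real.mul_self_sqrt (cellMass_nonneg V _)] at h3
    exact mul_le_mul hm (mul_le_mul (norm_cosCoeff_le hκ hR p.2) h3
      (by positivity) (cosBound_nonneg ((norm_nonneg _).trans hR) _)) (by positivity) hm0

theorem norm_blockCoeff_inl_le {κ : ℂ} (hκ : 0 ≤ κ.im) (p : ℤ × ℤ) :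
    ‖blockCoeff κ (.inl p)‖ ≤ 1 := by
  rw [blockCoeff]
  split_ifs with h
  · simp
  · refine norm_exp_I_mul_le_one hκ ?_
    have : (1 : ℤ) ≤ |p.1 - p.2| := Int.one_le_abs (sub_ne_zero.2 h)
    have h' : (1 : ℝ) ≤ |(p.1 : ℝ) - p.2| := by exact_mod_cast this
    linarith

/-- For `Im κ > 0` this decay away from the diagonal makes the expansion nuclear for every
integrable `V`. -/
theorem norm_blockCoeff_inl_le_exp (κ : ℂ) (p : ℤ × ℤ) :
    ‖blockCoeff κ (.inl p)‖ ≤ Real.exp κ.im * Real.exp (-κ.im * |((p.1 - p.2 : ℤ) : ℝ)|) := by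
  rw [blockCoeff, ← Real.exp_add]
  split_ifs with h
  · simpa using (Real.exp_pos _).le
  · rw [norm_exp]
    refine le_of_eq ?_
    congr 1
    simp only [mul_re, I_re, I_im, mul_im, ofReal_re, ofReal_im]
    push_cast
    ring

/-- The condition `ℓ^{1/2}` enters here: without off-diagonal decay the blocks contribute `(∑ⱼ
√mⱼ)²`, where `mⱼ` is the mass of the `j`-th cell. -/
theorem summable_bsBound_one {V : ℝ → ℝ} (hV : Integrable V)
    (h : Summable fun j => √(cellMass V j)) (m : ℝ) {R : ℝ} (hR : 0 ≤ R) :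
    Summable (bsBound V m R fun _ => 1) := by
  refine Summable.sum _ ?_ ?_
  · simp only [Function.comp_def, bsBound, one_mul]
    exact (h.mul_of_nonneg h (fun _ => Real.sqrt_nonneg _) fun _ => Real.sqrt_nonneg _).mul_left m
  · simp only [Function.comp_def, bsBound]
    exact ((summable_cellMass hV).mul_of_nonneg (summable_cosBound R) (cellMass_nonneg V)
      (cosBound_nonneg hR)).mul_left m

theorem summable_exp_neg_mul_abs_int {η : ℝ} (hη : 0 < η) :
    Summable fun n : ℤ => Real.exp (-η * |(n : ℝ)|) := by
  have h : Summable fun n : ℕ => Real.exp (n * -η) := Real.summable_exp_nat_mul_iff.2 (by linarith)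
  refine Summable.of_nat_of_neg (h.congr fun n => ?_) (h.congr fun n => ?_)
  · simp [mul_comm]
  · simp [mul_comm]

/-- Since `√a √b ≤ a + b`, each block is charged to the masses of its two cells, and the remaining
sum over `j - l` is geometric. -/
theorem summable_bsBound_exp {V : ℝ → ℝ} (hV : Integrable V) (m M : ℝ) {R η : ℝ} (hR : 0 ≤ R)
    (hM : 0 ≤ M) (hm : 0 ≤ m) (hη : 0 < η) :
    Summable (bsBound V m R fun p => M * Real.exp (-η * |((p.1 - p.2 : ℤ) : ℝ)|)) := by
  have hexp := summable_exp_neg_mul_abs_int hη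
  refine Summable.sum _ ?_ ?_
  · have h1 : Summable fun p : ℤ × ℤ =>
        cellMass V p.1 * Real.exp (-η * |((p.1 - p.2 : ℤ) : ℝ)|) := by
      let e : ℤ × ℤ ≃ ℤ × ℤ :=
        ⟨fun p => (p.1, p.1 - p.2), fun p => (p.1, p.1 - p.2), fun p => by simp, fun p => by simp⟩
      exact e.summable_iff.2 ((summable_cellMass hV).mul_of_nonneg hexp (cellMass_nonneg V)
        fun _ => (Real.exp_pos _).le)
    have h2 : Summable fun p : ℤ × ℤ =>
        cellMass V p.2 * Real.exp (-η * |((p.1 - p.2 : ℤ) : ℝ)|) := by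
      refine ((Equiv.prodComm ℤ ℤ).summable_iff.2 h1).congr fun p => ?_
      simp only [Function.comp_apply, Equiv.prodComm_apply, Prod.fst_swap, Prod.snd_swap]
      rw [← neg_sub p.2 p.1, Int.cast_neg, abs_neg]
    refine Summable.of_nonneg_of_le (fun p => ?_) (fun p => ?_) ((h1.add h2).mul_left (m * M))
    · simp only [Function.comp_apply, bsBound]
      positivity
    · simp only [Function.comp_apply, bsBound]
      have h3 : √(cellMass V p.1) * √(cellMass V p.2) ≤ cellMass V p.1 + cellMass V p.2 := by
        nlinarith [Real.sq_sqrt (cellMass_nonneg V p.1), Real.sq_sqrt (cellMass_nonneg V p.2),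
          sq_nonneg (√(cellMass V p.1) - √(cellMass V p.2)), cellMass_nonneg V p.1,
          cellMass_nonneg V p.2]
      calc m * (M * Real.exp (-η * |((p.1 - p.2 : ℤ) : ℝ)|) *
            (√(cellMass V p.1) * √(cellMass V p.2)))
          ≤ m * (M * Real.exp (-η * |((p.1 - p.2 : ℤ) : ℝ)|) *
            (cellMass V p.1 + cellMass V p.2)) := by gcongr
        _ = _ := by ring
  · simp only [Function.comp_def, bsBound]
    exact ((summable_cellMass hV).mul_of_nonneg (summable_cosBound R) (cellMass_nonneg V)
      (cosBound_nonneg hR)).mul_left m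

/-- The nuclear expansion of the Birman–Schwinger operator. -/
theorem isNuclearSum_bsLeft_bsRight {V : ℝ → ℝ} (hV : Integrable V) (s : CutSide) (z : ℂ)
    (hs : Summable fun n => ‖bsLeft V (waveNumber s z) n‖ * ‖bsRight V (waveNumber s z) n‖) :
    IsNuclearSum (birmanSchwinger V hV s z) (bsLeft V (waveNumber s z))
      (bsRight V (waveNumber s z)) := by
  have hκ := waveNumber_im_nonneg s z
  refine isNuclearSum_birmanSchwinger hV s z (measurable_blockLeft _) (norm_blockLeft_le hκ)
    (measurable_blockRight _) (norm_blockRight_le hκ) (fun x y => ?_) hs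
  rw [greenFn_eq]
  simpa only [mul_assoc] using (hasSum_block hκ x y).mul_left (-(I / (2 * waveNumber s z)))

theorem isNuclearSum_of_memBirmanSolomyak {V : ℝ → ℝ} (hV : Integrable V)
    (h : MemBirmanSolomyak (1 / 2) V) (s : CutSide) (z : ℂ) :
    IsNuclearSum (birmanSchwinger V hV s z) (bsLeft V (waveNumber s z))
      (bsRight V (waveNumber s z)) := by
  have hκ := waveNumber_im_nonneg s z
  exact isNuclearSum_bsLeft_bsRight hV s z (Summable.of_nonneg_of_le (fun n => by positivity)
    (norm_bsLeft_mul_norm_bsRight_le hV hκ le_rfl le_rfl (norm_blockCoeff_inl_le hκ))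
    (summable_bsBound_one hV h.summable_sqrt_cellMass _ (norm_nonneg _)))

theorem isNuclearSum_of_waveNumber_im_pos {V : ℝ → ℝ} (hV : Integrable V) (s : CutSide) (z : ℂ)
    (hκ : 0 < (waveNumber s z).im) :
    IsNuclearSum (birmanSchwinger V hV s z) (bsLeft V (waveNumber s z))
      (bsRight V (waveNumber s z)) :=
  isNuclearSum_bsLeft_bsRight hV s z (Summable.of_nonneg_of_le (fun n => by positivity)
    (norm_bsLeft_mul_norm_bsRight_le hV hκ.le le_rfl le_rfl (norm_blockCoeff_inl_le_exp _))
    (summable_bsBound_exp hV _ _ (norm_nonneg _) (Real.exp_pos _).le (norm_nonneg _) hκ))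

end Summability

/-! ### The resolvent identity for the free kernel -/

section ResolventIdentity

open Complex ComplexConjugate

theorem norm_exp_I_mul_abs (κ : ℂ) (t : ℝ) :
    ‖exp (I * κ * |t|)‖ = Real.exp (-κ.im * |t|) := by
  rw [norm_exp]
  congr 1
  simp only [mul_re, I_re, I_im, mul_im, ofReal_re, ofReal_im]
  ring

theorem integrable_exp_neg_mul_abs {η : ℝ} (hη : 0 < η) :
    Integrable fun w : ℝ => Real.exp (-η * |w|) := by
  have h1 : IntegrableOn (fun w : ℝ => Real.exp (-η * |w|)) (Set.Iic 0) :=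
    (integrableOn_exp_mul_Iic hη 0).congr_fun (fun w hw => by
      simp only [abs_of_nonpos (Set.mem_Iic.1 hw)]
      congr 1
      ring) measurableSet_Iic
  have h2 : IntegrableOn (fun w : ℝ => Real.exp (-η * |w|)) (Set.Ioi 0) :=
    (integrableOn_exp_mul_Ioi (neg_lt_zero.2 hη) 0).congr_fun (fun w hw => by
      simp only [abs_of_pos (Set.mem_Ioi.1 hw)]) measurableSet_Ioi
  have h := h1.union h2
  rwa [Set.Iic_union_Ioi, integrableOn_univ] at h

theorem norm_conj_exp_mul_exp_le {κ : ℂ} (hκ : 0 ≤ κ.im) (x y w : ℝ) :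
    ‖conj (exp (I * κ * |w - x|)) * exp (I * κ * |w - y|)‖ ≤ Real.exp (-κ.im * |w - x|) := by
  rw [norm_mul, RCLike.norm_conj, norm_exp_I_mul_abs]
  exact mul_le_of_le_one_right (Real.exp_pos _).le (norm_exp_I_mul_le_one hκ (abs_nonneg _))

theorem integrable_conj_exp_mul_exp {κ : ℂ} (hκ : 0 < κ.im) (x y : ℝ) :
    Integrable fun w : ℝ => conj (exp (I * κ * |w - x|)) * exp (I * κ * |w - y|) := by
  refine ((integrable_exp_neg_mul_abs hκ).comp_sub_right x).mono' ?_
    (ae_of_all _ fun w => norm_conj_exp_mul_exp_le hκ.le x y w)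
  exact Continuous.aestronglyMeasurable (by fun_prop)

theorem conj_exp_I_mul (κ : ℂ) (t : ℝ) :
    conj (exp (I * κ * t)) = exp (-(I * conj κ * t)) := by
  rw [← exp_conj]
  simp

/-- The absolute values resolve on each of `(-∞, x]`, `[x, y]`, `(y, ∞)`. The outer pieces produce
the denominator `2 Im κ`, the middle one `2i Re κ`, which explains the condition `Re κ ≠ 0`. -/
theorem integral_conj_exp_mul_exp_of_le {κ : ℂ} (hκ : 0 < κ.im) (hre : κ.re ≠ 0) {x y : ℝ}
    (hxy : x ≤ y) :
    ∫ w : ℝ, conj (exp (I * κ * |w - x|)) * exp (I * κ * |w - y|) =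
      (exp (I * κ * |x - y|) + conj (exp (I * κ * |x - y|))) / (2 * κ.im) +
      (exp (I * κ * |x - y|) - conj (exp (I * κ * |x - y|))) / (2 * κ.re * I) := by
  have him : (2 * κ.im : ℂ) = I * conj κ - I * κ := by
    apply Complex.ext <;> simp; ring
  have hre' : (2 * κ.re * I : ℂ) = I * conj κ + I * κ := by
    apply Complex.ext <;> simp; ring
  have hre0 : (2 * κ.re * I : ℂ) ≠ 0 :=
    mul_ne_zero (mul_ne_zero two_ne_zero (ofReal_ne_zero.2 hre)) I_ne_zero
  have hI := integrable_conj_exp_mul_exp hκ x y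
  rw [← intervalIntegral.integral_Iic_add_Ioi (b := x) hI.integrableOn hI.integrableOn,
    ← intervalIntegral.integral_interval_add_Ioi (a := x) (b := y) hI.integrableOn hI.integrableOn]
  simp only [conj_exp_I_mul]
  rw [abs_of_nonpos (sub_nonpos.2 hxy)]
  have e1 : ∫ w in Set.Iic x, exp (-(I * conj κ * |w - x|)) * exp (I * κ * |w - y|) =
      exp (I * κ * (-(x - y) : ℝ)) / (2 * κ.im) := by
    have : ∀ w ∈ Set.Iic x, exp (-(I * conj κ * |w - x|)) * exp (I * κ * |w - y|) =
        exp (I * κ * y - I * conj κ * x) * exp (2 * κ.im * w) := fun w hw => by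
      have hw' : w ≤ x := hw
      rw [abs_of_nonpos (by linarith : w - x ≤ 0), abs_of_nonpos (by linarith : w - y ≤ 0),
        ← exp_add, ← exp_add, him]
      congr 1
      push_cast
      ring
    rw [setIntegral_congr_fun measurableSet_Iic this, integral_const_mul,
      integral_exp_mul_complex_Iic (by simpa using hκ), ← mul_div_assoc, ← exp_add, him]
    congr 2
    push_cast
    ring
  have e2 : ∫ w in x..y, exp (-(I * conj κ * |w - x|)) * exp (I * κ * |w - y|) =
      (exp (I * κ * (-(x - y) : ℝ)) - exp (-(I * conj κ * (-(x - y) : ℝ)))) / (2 * κ.re * I) := by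
    have : Set.EqOn (fun w : ℝ => exp (-(I * conj κ * |w - x|)) * exp (I * κ * |w - y|))
        (fun w : ℝ => exp (I * conj κ * x + I * κ * y) * exp (-(2 * κ.re * I) * w))
        (Set.uIcc x y) := fun w hw => by
      rw [Set.uIcc_of_le hxy] at hw
      simp only
      rw [abs_of_nonneg (by linarith [hw.1] : 0 ≤ w - x),
        abs_of_nonpos (by linarith [hw.2] : w - y ≤ 0), ← exp_add, ← exp_add, hre']
      congr 1
      push_cast
      ring
    rw [intervalIntegral.integral_congr this, intervalIntegral.integral_const_mul,
      integral_exp_mul_complex (neg_ne_zero.2 hre0), ← mul_div_assoc, mul_sub, ← exp_add,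
      ← exp_add, div_neg, ← neg_div, neg_sub, hre']
    congr 3 <;> push_cast <;> ring
  have e3 : ∫ w in Set.Ioi y, exp (-(I * conj κ * |w - x|)) * exp (I * κ * |w - y|) =
      exp (-(I * conj κ * (-(x - y) : ℝ))) / (2 * κ.im) := by
    have : ∀ w ∈ Set.Ioi y, exp (-(I * conj κ * |w - x|)) * exp (I * κ * |w - y|) =
        exp (I * conj κ * x - I * κ * y) * exp (-(2 * κ.im) * w) := fun w hw => by
      have hw' : y < w := hw
      rw [abs_of_nonneg (by linarith : 0 ≤ w - x), abs_of_nonneg (by linarith : 0 ≤ w - y),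
        ← exp_add, ← exp_add, him]
      congr 1
      push_cast
      ring
    rw [setIntegral_congr_fun measurableSet_Ioi this, integral_const_mul,
      integral_exp_mul_complex_Ioi (by simpa using hκ), neg_div_neg_eq, ← mul_div_assoc,
      ← exp_add, him]
    congr 2
    push_cast
    ring
  rw [e1, e2, e3]
  ring

theorem integral_conj_exp_mul_exp {κ : ℂ} (hκ : 0 < κ.im) (hre : κ.re ≠ 0) (x y : ℝ) :
    ∫ w : ℝ, conj (exp (I * κ * |w - x|)) * exp (I * κ * |w - y|) =
      (exp (I * κ * |x - y|) + conj (exp (I * κ * |x - y|))) / (2 * κ.im) +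
      (exp (I * κ * |x - y|) - conj (exp (I * κ * |x - y|))) / (2 * κ.re * I) := by
  rcases le_total x y with hxy | hxy
  · exact integral_conj_exp_mul_exp_of_le hκ hre hxy
  · have h := congrArg conj (integral_conj_exp_mul_exp_of_le hκ hre hxy)
    rw [← integral_conj, abs_sub_comm y x] at h
    calc _ = _ := integral_congr_ae (ae_of_all _ fun w => by
          simp only [map_mul, conj_conj]; ring)
      _ = _ := h
      _ = _ := by
        simp only [map_add, map_div₀, map_sub, map_mul, conj_conj, conj_ofReal, conj_I, map_ofNat]
        have hre0 : (κ.re : ℂ) ≠ 0 := ofReal_ne_zero.2 hre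
        have him0 : (κ.im : ℂ) ≠ 0 := ofReal_ne_zero.2 hκ.ne'
        field_simp
        ring

/-- This is `R - R* = (z̄ - z) R* R` at the level of kernels, obtained by evaluating the composition
integral explicitly. -/
theorem greenFn_sub_conj (s : CutSide) (z : ℂ) (hκ : 0 < (waveNumber s z).im)
    (hre : (waveNumber s z).re ≠ 0) (x y : ℝ) :
    greenFn s z x y - conj (greenFn s z x y) =
      (conj z - z) * ∫ w : ℝ, conj (greenFn s z w x) * greenFn s z w y := by
  have hz := waveNumber_sq s z
  simp only [greenFn_eq]
  set κ := waveNumber s z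
  have hmul : ∀ w : ℝ, conj (-(I / (2 * κ)) * exp (I * κ * |w - x|)) *
      (-(I / (2 * κ)) * exp (I * κ * |w - y|)) = conj (-(I / (2 * κ))) * (-(I / (2 * κ))) *
        (conj (exp (I * κ * |w - x|)) * exp (I * κ * |w - y|)) := fun w => by
    rw [map_mul]
    ring
  simp only [hmul]
  rw [integral_const_mul, integral_conj_exp_mul_exp hκ hre, map_mul, ← hz]
  have him : (2 * κ.im : ℂ) = I * (conj κ - κ) := by
    apply Complex.ext <;> simp; ring
  have hre' : (2 * κ.re * I : ℂ) = I * (conj κ + κ) := by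
    apply Complex.ext <;> simp; ring
  have him0 : conj κ - κ ≠ 0 := by
    intro h
    rw [h, mul_zero] at him
    exact mul_ne_zero two_ne_zero (ofReal_ne_zero.2 hκ.ne') him
  have hre0 : conj κ + κ ≠ 0 := by
    intro h
    rw [h, mul_zero] at hre'
    exact mul_ne_zero (mul_ne_zero two_ne_zero (ofReal_ne_zero.2 hre)) I_ne_zero hre'
  have hκ0 : κ ≠ 0 := fun h => by rw [h] at hκ; simp at hκ
  have hκ0' : conj κ ≠ 0 := by simpa using hκ0
  rw [him, hre']
  simp only [map_neg, map_div₀, map_mul, conj_I, map_pow, map_ofNat]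
  generalize exp (I * κ * |x - y|) = E
  generalize conj E = E'
  generalize conj κ = κ' at *
  field_simp
  ring

end ResolventIdentity

/-! ### Uniqueness for Volterra inequalities -/

section Volterra

/-- On `(s, ∞)` only the mass of `W` in `T` counts, and there the inequality halves any uniform
bound on `u`; iteration gives `u = 0`. -/
theorem volterra_zero_step {u W : ℝ → ℝ} {B C : ℝ} (hC : 0 ≤ C) (hu : ∀ x, 0 ≤ u x)
    (huB : ∀ x, u x ≤ B) (hW : Integrable W) (hW0 : ∀ x, 0 ≤ W x)
    (hWu : Integrable fun x => W x * u x) (h : ∀ x, u x ≤ C * ∫ y in Set.Ioi x, W y * u y)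
    {s : ℝ} {T : Set ℝ} (hT : MeasurableSet T) (hout : ∀ y > s, y ∉ T → u y = 0)
    (hsmall : C * ∫ y in Set.Ioi s ∩ T, W y ≤ 1 / 2) {x : ℝ} (hx : s < x) : u x = 0 := by
  have hB : 0 ≤ B := (hu 0).trans (huB 0)
  have key : ∀ n : ℕ, ∀ x > s, u x ≤ B * (1 / 2) ^ n := by
    intro n
    induction n with
    | zero => intro x _; simpa using huB x
    | succ n ih =>
      intro x hx
      have h1 : ∫ y in Set.Ioi x, W y * u y ≤
          ∫ y in Set.Ioi s ∩ T, W y * (B * (1 / 2) ^ n) := by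
        rw [← integral_indicator measurableSet_Ioi,
          ← integral_indicator (measurableSet_Ioi.inter hT)]
        refine integral_mono (hWu.indicator measurableSet_Ioi)
          ((hW.mul_const _).indicator (measurableSet_Ioi.inter hT)) fun y => ?_
        by_cases hy : y ∈ Set.Ioi x
        · rw [Set.indicator_of_mem hy]
          have hys : s < y := hx.trans hy
          by_cases hyT : y ∈ T
          · rw [Set.indicator_of_mem (Set.mem_inter (Set.mem_Ioi.2 hys) hyT)]
            exact mul_le_mul_of_nonneg_left (ih y hys) (hW0 y)
          · rw [hout y hys hyT, mul_zero]
            exact Set.indicator_nonneg (fun y _ => mul_nonneg (hW0 y) (by positivity)) y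
        · rw [Set.indicator_of_notMem hy]
          exact Set.indicator_nonneg (fun y _ => mul_nonneg (hW0 y) (by positivity)) y
      rw [integral_mul_const] at h1
      calc u x ≤ C * ∫ y in Set.Ioi x, W y * u y := h x
        _ ≤ C * ((∫ y in Set.Ioi s ∩ T, W y) * (B * (1 / 2) ^ n)) :=
          mul_le_mul_of_nonneg_left h1 hC
        _ = (C * ∫ y in Set.Ioi s ∩ T, W y) * (B * (1 / 2) ^ n) := by ring
        _ ≤ 1 / 2 * (B * (1 / 2) ^ n) := mul_le_mul_of_nonneg_right hsmall (by positivity)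
        _ = B * (1 / 2) ^ (n + 1) := by ring
  refine le_antisymm (ge_of_tendsto' (f := fun n : ℕ => B * (1 / 2 : ℝ) ^ n) (x := atTop) ?_
    fun n => key n x hx) (hu x)
  simpa using (tendsto_pow_atTop_nhds_zero_of_lt_one (r := (1 / 2 : ℝ)) (by norm_num)
    (by norm_num)).const_mul B

/-- Continuation from `+∞`: the set of `t` beyond which `u` vanishes is nonempty because tails of
`W` are small. A finite infimum could be lowered, since `W` has little mass just to its left. -/
theorem volterra_zero {u W : ℝ → ℝ} {B C : ℝ} (hC : 0 ≤ C) (hu : ∀ x, 0 ≤ u x)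
    (huB : ∀ x, u x ≤ B) (hW : Integrable W) (hW0 : ∀ x, 0 ≤ W x)
    (hWu : Integrable fun x => W x * u x) (h : ∀ x, u x ≤ C * ∫ y in Set.Ioi x, W y * u y)
    (x : ℝ) : u x = 0 := by
  let A : Set ℝ := {t | ∀ x > t, u x = 0}
  have hdown : ∀ {t}, t ∈ A → ∀ {t'}, t ≤ t' → t' ∈ A := fun ht _ h' x hx =>
    ht x (lt_of_le_of_lt h' hx)
  have hA : A.Nonempty := by
    have hlim := intervalIntegral_tendsto_integral_Ioi (μ := volume) 0 hW.integrableOn tendsto_id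
    have hlim' : Tendsto (fun t : ℝ => C * ∫ y in Set.Ioi t, W y) atTop (𝓝 0) := by
      have := ((tendsto_const_nhds (x := ∫ y in Set.Ioi (0 : ℝ), W y)).sub hlim).const_mul C
      rw [sub_self, mul_zero] at this
      refine this.congr fun t => ?_
      rw [← intervalIntegral.integral_interval_add_Ioi (a := 0) (b := t) hW.integrableOn
        hW.integrableOn, id, add_sub_cancel_left]
    obtain ⟨t, ht⟩ := (hlim'.eventually (gt_mem_nhds (by norm_num : (0 : ℝ) < 1 / 2))).exists
    refine ⟨t, fun x hx => volterra_zero_step hC hu huB hW hW0 hWu h (T := Set.univ)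
      MeasurableSet.univ (fun y _ hy => absurd (Set.mem_univ y) hy) ?_ hx⟩
    rw [Set.inter_univ]
    exact ht.le
  by_cases hbdd : BddBelow A
  · exfalso
    set t₀ := sInf A
    have ht₀ : t₀ ∈ A := fun y hy => by
      obtain ⟨t, ht, hty⟩ := exists_lt_of_csInf_lt hA hy
      exact ht y hty
    have hcont : Continuous fun s => C * ∫ y in t₀..s, W y :=
      continuous_const.mul
        (intervalIntegral.continuous_primitive (fun a b => hW.intervalIntegrable) t₀)
    have hev : ∀ᶠ s in 𝓝 t₀, -(1 / 2) < C * ∫ y in t₀..s, W y := by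
      refine hcont.continuousAt.eventually (lt_mem_nhds ?_)
      simp
    obtain ⟨s, hs, hlt⟩ : ∃ s, (-(1 / 2) < C * ∫ y in t₀..s, W y) ∧ s < t₀ := by
      have h2 := (hev.filter_mono nhdsWithin_le_nhds).and
        (self_mem_nhdsWithin : Set.Iio t₀ ∈ 𝓝[<] t₀)
      exact h2.exists
    have hsA : s ∈ A := fun x hx => volterra_zero_step hC hu huB hW hW0 hWu h
      (T := Set.Iic t₀) measurableSet_Iic (fun y _ hy => ht₀ y (not_le.1 hy)) (by
        rw [Set.Ioi_inter_Iic, ← intervalIntegral.integral_of_le hlt.le,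
          intervalIntegral.integral_symm]
        linarith) hx
    exact absurd (csInf_le hbdd hsA) (not_le.2 hlt)
  · obtain ⟨t, ht, htx⟩ := not_bddBelow_iff.1 hbdd x
    exact ht x htx

end Volterra

/-! ### Injectivity of `1 - K_∞(z)` -/

section Injectivity

open Complex ComplexConjugate

theorem integrable_conj_comp {α : Type*} [MeasurableSpace α] {μ : Measure α} {g : α → ℂ}
    (hg : Integrable g μ) : Integrable (fun x => conj (g x)) μ :=
  hg.mono (continuous_conj.comp_aestronglyMeasurable hg.1)
    (ae_of_all _ fun x => (RCLike.norm_conj (g x)).le)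

theorem Continuous.greenFn {X : Type*} [TopologicalSpace X] {f g : X → ℝ} (hf : Continuous f)
    (hg : Continuous g) (s : CutSide) (z : ℂ) : Continuous fun x => greenFn s z (f x) (g x) :=
  (continuous_greenFn s z).comp (hf.prodMk hg)

theorem greenFn_comm (s : CutSide) (z : ℂ) (x y : ℝ) : greenFn s z x y = greenFn s z y x := by
  rw [greenFn_eq, greenFn_eq, abs_sub_comm]

theorem integrable_conj_mul_mul_greenFn (s : CutSide) (z : ℂ) {g : ℝ → ℂ} (hg : Integrable g) :
    Integrable (fun p : ℝ × ℝ => greenFn s z p.1 p.2 * (conj (g p.1) * g p.2))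
      (volume.prod volume) :=
  ((integrable_conj_comp hg).mul_prod hg).bdd_mul (continuous_greenFn s z).aestronglyMeasurable
    (ae_of_all _ fun w => norm_greenFn_le s z w.1 w.2)

/-- If the quadratic form of the free resolvent is real at `g`, that of its imaginary part
vanishes at `g`. -/
theorem integral_greenFn_sub_conj_eq_zero (s : CutSide) (z : ℂ) {g : ℝ → ℂ} (hg : Integrable g)
    (hreal : conj (∫ x, conj (g x) * ∫ y, greenFn s z x y * g y) =
      ∫ x, conj (g x) * ∫ y, greenFn s z x y * g y) :
    ∫ p : ℝ × ℝ, (greenFn s z p.1 p.2 - conj (greenFn s z p.1 p.2)) * (conj (g p.1) * g p.2)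
      ∂(volume.prod volume) = 0 := by
  have hI := integrable_conj_mul_mul_greenFn s z hg
  have hQ : ∫ x, conj (g x) * ∫ y, greenFn s z x y * g y =
      ∫ p : ℝ × ℝ, greenFn s z p.1 p.2 * (conj (g p.1) * g p.2) ∂(volume.prod volume) := by
    rw [integral_prod _ hI]
    refine integral_congr_ae (ae_of_all _ fun x => ?_)
    simp only
    rw [← integral_const_mul]
    refine integral_congr_ae (ae_of_all _ fun y => ?_)
    simp only
    ring
  have hswap : Integrable (fun p : ℝ × ℝ => conj (greenFn s z p.1 p.2) * (conj (g p.1) * g p.2))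
      (volume.prod volume) := by
    have h := (integrable_conj_comp hI).swap
    refine h.congr (ae_of_all _ fun p => ?_)
    simp only [Function.comp_apply, Prod.fst_swap, Prod.snd_swap, map_mul,
      conj_conj, greenFn_comm s z p.2 p.1]
    ring
  have hQ' : conj (∫ x, conj (g x) * ∫ y, greenFn s z x y * g y) =
      ∫ p : ℝ × ℝ, conj (greenFn s z p.1 p.2) * (conj (g p.1) * g p.2)
        ∂(volume.prod volume) := by
    rw [hQ, ← integral_conj, ← integral_prod_swap]
    refine integral_congr_ae (ae_of_all _ fun p => ?_)
    simp only [Prod.fst_swap, Prod.snd_swap, map_mul, conj_conj, greenFn_comm s z p.2 p.1]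
    ring
  simp only [sub_mul]
  rw [integral_sub hI hswap, ← hQ, ← hQ', hreal, sub_self]

/-- By `greenFn_sub_conj` and Fubini the vanishing form equals `(z̄ - z) ∫ |ψ|²`, where `ψ = Rg`.
The decay `exp(-Im κ |w - x|)` makes the triple integral absolutely convergent. -/
theorem integral_conj_greenFn_mul_eq_zero (s : CutSide) (z : ℂ) (hκ : 0 < (waveNumber s z).im)
    (hre : (waveNumber s z).re ≠ 0) (hz : z.im ≠ 0) {g : ℝ → ℂ} (hg : Integrable g)
    (hreal : conj (∫ x, conj (g x) * ∫ y, greenFn s z x y * g y) =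
      ∫ x, conj (g x) * ∫ y, greenFn s z x y * g y) :
    ∀ᵐ w, ∫ y, greenFn s z w y * g y = 0 := by
  set κ := waveNumber s z with hκdef
  set M := ‖-(I / (2 * κ))‖ with hM
  have hprod : ∀ x y w : ℝ, ‖conj (greenFn s z w x) * greenFn s z w y‖ ≤
      M ^ 2 * Real.exp (-κ.im * |w - x|) := fun x y w => by
    have h1 := norm_conj_exp_mul_exp_le hκ.le x y w
    rw [greenFn_eq, greenFn_eq, ← hκdef, map_mul]
    calc ‖conj (-(I / (2 * κ))) * conj (exp (I * κ * |w - x|)) *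
          (-(I / (2 * κ)) * exp (I * κ * |w - y|))‖
        = M ^ 2 * ‖conj (exp (I * κ * |w - x|)) * exp (I * κ * |w - y|)‖ := by
          rw [norm_mul, norm_mul, norm_mul, norm_mul, RCLike.norm_conj, hM]
          ring
      _ ≤ _ := by gcongr
  have hexp := integrable_exp_neg_mul_abs hκ
  have hcontw : ∀ x : ℝ, Continuous fun w : ℝ => greenFn s z w x := fun x =>
    continuous_id.greenFn continuous_const s z
  have hIw : ∀ x y : ℝ, Integrable fun w : ℝ => conj (greenFn s z w x) * greenFn s z w y :=
    fun x y => ((hexp.comp_sub_right x).const_mul (M ^ 2)).mono'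
      ((continuous_conj.comp (hcontw x)).mul (hcontw y)).aestronglyMeasurable
      (ae_of_all _ fun w => hprod x y w)
  let Φ : (ℝ × ℝ) × ℝ → ℂ := fun q =>
    conj (greenFn s z q.2 q.1.1) * greenFn s z q.2 q.1.2 * (conj (g q.1.1) * g q.1.2)
  have hgg : Integrable (fun p : ℝ × ℝ => conj (g p.1) * g p.2) (volume.prod volume) :=
    (integrable_conj_comp hg).mul_prod hg
  have hΦm : AEStronglyMeasurable Φ ((volume.prod volume).prod volume) := by
    have h1 : Continuous fun q : (ℝ × ℝ) × ℝ =>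
        conj (greenFn s z q.2 q.1.1) * greenFn s z q.2 q.1.2 :=
      (continuous_conj.comp (continuous_snd.greenFn (continuous_fst.comp continuous_fst) s z)).mul
        (continuous_snd.greenFn (continuous_snd.comp continuous_fst) s z)
    exact h1.aestronglyMeasurable.mul hgg.1.comp_fst
  have hΦ : Integrable Φ ((volume.prod volume).prod volume) := by
    rw [integrable_prod_iff hΦm]
    refine ⟨ae_of_all _ fun p => (hIw p.1 p.2).mul_const (conj (g p.1) * g p.2), ?_⟩
    refine (hgg.norm.const_mul (M ^ 2 * ∫ w, Real.exp (-κ.im * |w|))).mono'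
      hΦm.norm.integral_prod_right' (ae_of_all _ fun p => ?_)
    rw [Real.norm_of_nonneg (integral_nonneg fun _ => norm_nonneg _)]
    simp only [Φ]
    simp_rw [norm_mul (_ * _) (conj (g p.1) * g p.2)]
    rw [integral_mul_const]
    refine mul_le_mul_of_nonneg_right ?_ (norm_nonneg _)
    rw [← integral_const_mul, ← integral_sub_right_eq_self
      (fun w => M ^ 2 * Real.exp (-κ.im * |w|)) p.1]
    exact integral_mono (hIw p.1 p.2).norm ((hexp.comp_sub_right p.1).const_mul (M ^ 2))
      fun w => hprod p.1 p.2 w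
  have hinner : ∀ w, ∫ p : ℝ × ℝ, Φ (p, w) ∂(volume.prod volume) =
      ((‖∫ y, greenFn s z w y * g y‖ ^ 2 : ℝ) : ℂ) := fun w => by
    have h1 : ∀ p : ℝ × ℝ, Φ (p, w) =
        conj (greenFn s z w p.1 * g p.1) * (greenFn s z w p.2 * g p.2) := fun p => by
      simp only [Φ, map_mul]
      ring
    simp only [h1]
    rw [integral_prod_mul (fun x => conj (greenFn s z w x * g x)) fun y => greenFn s z w y * g y,
      integral_conj, ← normSq_eq_conj_mul_self, normSq_eq_norm_sq]
  have h0 := integral_greenFn_sub_conj_eq_zero s z hg hreal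
  have h1 : ∫ p : ℝ × ℝ, ∫ w, Φ (p, w) ∂volume ∂(volume.prod volume) = 0 := by
    have h2 : ∀ p : ℝ × ℝ, (greenFn s z p.1 p.2 - conj (greenFn s z p.1 p.2)) *
        (conj (g p.1) * g p.2) = (conj z - z) * ∫ w, Φ (p, w) := fun p => by
      rw [greenFn_sub_conj s z hκ hre]
      simp only [Φ]
      rw [integral_mul_const]
      ring
    simp only [h2] at h0
    rw [integral_const_mul] at h0
    refine (mul_eq_zero.1 h0).resolve_left fun h => hz ?_
    have := congrArg im h
    simp only [sub_im, conj_im, zero_im] at this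
    linarith
  rw [integral_integral_swap (f := fun p w => Φ (p, w)) hΦ] at h1
  simp only [hinner] at h1
  rw [integral_complex_ofReal] at h1
  have hint : Integrable fun w => ‖∫ y, greenFn s z w y * g y‖ ^ 2 := by
    have h := hΦ.integral_prod_right.norm
    refine h.congr (ae_of_all _ fun w => ?_)
    simp only [hinner]
    rw [norm_real, Real.norm_of_nonneg (by positivity)]
  have h3 := (integral_eq_zero_iff_of_nonneg (fun w => by positivity) hint).1 (ofReal_eq_zero.1 h1)
  filter_upwards [h3] with w hw
  simpa using hw

/-- On the cut there is no decay and `ψ = Rg` need not be square integrable. The vanishing form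
controls only the Fourier transform of `g` at the two frequencies `±a`; the relation `‖g‖ = W‖ψ‖`
then closes a Volterra inequality for `‖ψ‖`. -/
theorem integral_greenFn_mul_eq_zero_of_real (s : CutSide) (z : ℂ) {a : ℝ}
    (hκ : waveNumber s z = a) (ha : a ≠ 0) {g : ℝ → ℂ} (hg : Integrable g) {W : ℝ → ℝ}
    (hW : Integrable W) (hW0 : ∀ x, 0 ≤ W x)
    (hgW : ∀ᵐ x, ‖g x‖ = W x * ‖∫ y, greenFn s z x y * g y‖)
    (hreal : conj (∫ x, conj (g x) * ∫ y, greenFn s z x y * g y) =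
      ∫ x, conj (g x) * ∫ y, greenFn s z x y * g y) (x : ℝ) :
    ∫ y, greenFn s z x y * g y = 0 := by
  have hG : ∀ x y, greenFn s z x y = -(I / (2 * a)) * exp (I * a * |x - y|) := fun x y => by
    rw [greenFn_eq, hκ]
  have hE : ∀ t : ℝ, ‖exp (I * a * t)‖ = 1 := fun t => by
    rw [show I * (a : ℂ) * t = ((a * t : ℝ) : ℂ) * I by push_cast; ring, norm_exp_ofReal_mul_I]
  have hEI : ∀ b : ℝ, Integrable fun y : ℝ => exp (I * b * y) * g y := fun b => by
    refine hg.bdd_mul (c := 1) (Continuous.aestronglyMeasurable (by fun_prop))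
      (ae_of_all _ fun y => ?_)
    rw [show I * (b : ℂ) * y = ((b * y : ℝ) : ℂ) * I by push_cast; ring, norm_exp_ofReal_mul_I]
  -- The anti-Hermitian part of the kernel is `-(i/2a) · 2 cos(a(x-y))`, a sum of two rank one
  -- kernels.
  have hsub : ∀ p : ℝ × ℝ, (greenFn s z p.1 p.2 - conj (greenFn s z p.1 p.2)) *
      (conj (g p.1) * g p.2) = -(I / (2 * a)) *
      (conj (exp (I * (-a : ℝ) * p.1) * g p.1) * (exp (I * (-a : ℝ) * p.2) * g p.2) +
        conj (exp (I * a * p.1) * g p.1) * (exp (I * a * p.2) * g p.2)) := fun p => by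
    have h1 : exp (I * a * |p.1 - p.2|) + conj (exp (I * a * |p.1 - p.2|)) =
        conj (exp (I * (-a : ℝ) * p.1)) * exp (I * (-a : ℝ) * p.2) +
          conj (exp (I * a * p.1)) * exp (I * a * p.2) := by
      simp only [conj_exp_I_mul, conj_ofReal, ← exp_add]
      rcases abs_cases (p.1 - p.2) with ⟨h, -⟩ | ⟨h, -⟩
      · rw [h]
        congr 2 <;> push_cast <;> ring
      · rw [h, add_comm]
        congr 2 <;> push_cast <;> ring
    have h2 : conj (-(I / (2 * (a : ℂ)))) = I / (2 * a) := by
      simp only [map_neg, map_div₀, map_mul, conj_I, map_ofNat, conj_ofReal, neg_div, neg_neg]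
    rw [hG, map_mul, h2, map_mul, map_mul]
    linear_combination (-(I / (2 * (a : ℂ)))) * (conj (g p.1) * g p.2) * h1
  have h0 := integral_greenFn_sub_conj_eq_zero s z hg hreal
  simp only [hsub] at h0
  have hnorm : ∀ b : ℝ, ∫ p : ℝ × ℝ, conj (exp (I * b * p.1) * g p.1) * (exp (I * b * p.2) * g p.2)
      ∂(volume.prod volume) = ((‖∫ y : ℝ, exp (I * b * y) * g y‖ ^ 2 : ℝ) : ℂ) := fun b => by
    rw [integral_prod_mul (fun x : ℝ => conj (exp (I * b * x) * g x)) fun y : ℝ =>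
      exp (I * b * y) * g y, integral_conj, ← normSq_eq_conj_mul_self, normSq_eq_norm_sq]
  have hprodI : ∀ b : ℝ, Integrable (fun p : ℝ × ℝ =>
      conj (exp (I * b * p.1) * g p.1) * (exp (I * b * p.2) * g p.2)) (volume.prod volume) :=
    fun b => (integrable_conj_comp (hEI b)).mul_prod (hEI b)
  rw [integral_const_mul, integral_add (hprodI (-a)) (hprodI a), hnorm, hnorm, ← ofReal_add] at h0
  have h1 := ofReal_eq_zero.1 ((mul_eq_zero.1 h0).resolve_left (by simp [ha]))
  have hzero : ∫ y : ℝ, exp (I * (-a : ℝ) * y) * g y = 0 := by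
    have h2 : ‖∫ y : ℝ, exp (I * (-a : ℝ) * y) * g y‖ ^ 2 = 0 := by
      nlinarith [sq_nonneg ‖∫ y : ℝ, exp (I * (-a : ℝ) * y) * g y‖,
        sq_nonneg ‖∫ y : ℝ, exp (I * a * y) * g y‖]
    simpa using h2
  set ψ : ℝ → ℂ := fun x => ∫ y, greenFn s z x y * g y with hψ
  set M := ‖I / (2 * (a : ℂ))‖ with hM
  -- Subtracting `-(i/2a) exp(ia(x-y))` from the kernel is free because the corresponding Fourier
  -- integral of `g` vanishes. It cancels the kernel for `y ≤ x`, so only `y > x` contributes.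
  have hbound : ∀ x, ‖ψ x‖ ≤ 2 * M * ∫ y in Set.Ioi x, ‖g y‖ := fun x => by
    have h2 : ψ x = ∫ y, (greenFn s z x y * g y -
        (-(I / (2 * a)) * exp (I * a * x)) * (exp (I * (-a : ℝ) * y) * g y)) := by
      rw [integral_sub (integrable_greenFn_mul hg x) ((hEI (-a)).const_mul _), integral_const_mul,
        hzero, mul_zero, sub_zero]
    rw [h2, ← integral_const_mul, ← integral_indicator measurableSet_Ioi]
    refine norm_integral_le_of_norm_le ((hg.norm.const_mul _).indicator measurableSet_Ioi)
      (ae_of_all _ fun y => ?_)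
    have h3 : greenFn s z x y * g y -
        (-(I / (2 * a)) * exp (I * a * x)) * (exp (I * (-a : ℝ) * y) * g y) =
        -(I / (2 * a)) * (exp (I * a * |x - y|) - exp (I * a * (x - y : ℝ))) * g y := by
      have h4 : exp (I * a * (x - y : ℝ)) = exp (I * a * x) * exp (I * (-a : ℝ) * y) := by
        rw [← exp_add]
        congr 1
        push_cast
        ring
      rw [hG, h4]
      ring
    rw [h3]
    by_cases hy : y ∈ Set.Ioi x
    · rw [Set.indicator_of_mem hy, norm_mul, norm_mul, norm_neg]
      have h5 : ‖exp (I * a * |x - y|) - exp (I * a * (x - y : ℝ))‖ ≤ 2 := by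
        refine (norm_sub_le _ _).trans ?_
        rw [hE, hE]
        norm_num
      refine mul_le_mul_of_nonneg_right ?_ (norm_nonneg _)
      rw [mul_comm 2 M]
      exact mul_le_mul_of_nonneg_left h5 (norm_nonneg _)
    · rw [Set.indicator_of_notMem hy, abs_of_nonneg (by
        have := not_lt.1 (Set.mem_Ioi.not.1 hy); linarith), sub_self]
      simp
  have hgW' : (fun y => ‖g y‖) =ᵐ[volume] fun y => W y * ‖ψ y‖ := hgW
  have huB : ∀ x, ‖ψ x‖ ≤ 2 * M * ∫ y, ‖g y‖ := fun x =>
    (hbound x).trans (mul_le_mul_of_nonneg_left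
      (setIntegral_le_integral hg.norm (ae_of_all _ fun y => norm_nonneg _)) (by positivity))
  have := volterra_zero (u := fun x => ‖ψ x‖) (W := W) (by positivity : 0 ≤ 2 * M)
    (fun x => norm_nonneg _) huB hW hW0 (hg.norm.congr hgW') (fun x => by
      rw [← setIntegral_congr_ae measurableSet_Ioi (hgW'.mono fun y hy _ => hy)]
      exact hbound x) x
  simpa using this

/-- `1 - K_∞(z)` is injective if `z` is not real or if `z > 0`. -/
theorem eq_zero_of_birmanSchwinger_apply_eq {V : ℝ → ℝ} (hV : Integrable V) (s : CutSide) {z : ℂ}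
    (hz : z.im ≠ 0 ∨ 0 < z.re) {f : L2R} (hf : birmanSchwinger V hV s z f = f) : f = 0 := by
  set g : ℝ → ℂ := fun y => ((√|V y| * signJ V y : ℝ) : ℂ) * f y with hgdef
  have hg : Integrable g := integrable_sqrtAbs_mul_signJ_mul hV f
  set ψ : ℝ → ℂ := fun x => ∫ y, greenFn s z x y * g y with hψ
  have hfψ : ∀ᵐ x, f x = ((√|V x| : ℝ) : ℂ) * ψ x := by
    have h := birmanSchwinger_ae hV s z f
    rw [hf] at h
    filter_upwards [h] with x hx
    rw [hx, integral_bsKernel_mul]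
  -- Inserting `f = √|V| ψ` turns the integrand into `J|V||ψ|² = V|ψ|²`, which is real.
  have hreal : conj (∫ x, conj (g x) * ψ x) = ∫ x, conj (g x) * ψ x := by
    rw [← integral_conj]
    refine integral_congr_ae ?_
    filter_upwards [hfψ] with x hx
    simp only [hgdef, map_mul, conj_ofReal, conj_conj]
    rw [hx]
    simp only [map_mul, conj_ofReal]
    ring
  have hgW : ∀ᵐ x, ‖g x‖ = |V x| * ‖ψ x‖ := by
    filter_upwards [hfψ] with x hx
    simp only [hgdef]
    rw [hx, ofReal_mul, norm_mul, norm_mul, norm_mul, norm_signJ, norm_real,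
      Real.norm_of_nonneg (Real.sqrt_nonneg _), mul_one, ← mul_assoc,
      Real.mul_self_sqrt (abs_nonneg _)]
  have hψ0 : ∀ᵐ x, ψ x = 0 := by
    have hsq := waveNumber_sq s z
    have hnn := waveNumber_im_nonneg s z
    have him : z.im = 2 * (waveNumber s z).re * (waveNumber s z).im := by
      conv_lhs => rw [← hsq]
      simp only [sq, mul_im]
      ring
    have hre : z.re = (waveNumber s z).re ^ 2 - (waveNumber s z).im ^ 2 := by
      conv_lhs => rw [← hsq]
      simp only [sq, mul_re]
    by_cases hzi : z.im = 0
    · have hzr : 0 < z.re := hz.resolve_left (not_not.2 hzi)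
      have hκre : (waveNumber s z).re ≠ 0 := fun h => by
        rw [h] at hre
        nlinarith [sq_nonneg (waveNumber s z).im]
      have hκim : (waveNumber s z).im = 0 := by
        rw [hzi] at him
        simpa [hκre] using him.symm
      refine ae_of_all _ (integral_greenFn_mul_eq_zero_of_real s z
        (a := (waveNumber s z).re) ?_ hκre hg hV.abs (fun x => abs_nonneg _) hgW hreal)
      apply Complex.ext <;> simp [hκim]
    · have hκim : 0 < (waveNumber s z).im := lt_of_le_of_ne hnn fun h => hzi (by
        rw [him, ← h, mul_zero])
      have hκre : (waveNumber s z).re ≠ 0 := fun h => hzi (by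
        rw [him, h, mul_zero, zero_mul])
      exact integral_conj_greenFn_mul_eq_zero s z hκim hκre hzi hg hreal
  rw [Lp.eq_zero_iff_ae_eq_zero]
  filter_upwards [hfψ, hψ0] with x h1 h2
  rw [h1, h2, mul_zero, Pi.zero_apply]

end Injectivity

/-! ### Invertibility of `1 - K_∞(z)` -/

section Invertibility

open Complex ComplexConjugate

theorem norm_sq_toLp_eq {V : ℝ → ℝ} {h : ℝ → ℂ} (hm : MemLp h 2)
    (hh : ∀ x, ‖h x‖ ^ 2 = |V x|) : ‖hm.toLp‖ ^ 2 = potentialNorm V := by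
  rw [L2R.norm_sq_eq_integral, potentialNorm]
  refine integral_congr_ae ?_
  filter_upwards [hm.coeFn_toLp] with x hx
  rw [hx, hh]

theorem norm_birmanSchwinger_le {V : ℝ → ℝ} (hV : Integrable V) (s : CutSide) (z : ℂ) :
    ‖birmanSchwinger V hV s z‖ ≤ ‖I / (2 * Complex.sqrt z)‖ * potentialNorm V := by
  have h1 := norm_sq_toLp_eq (V := V) (memLp_sqrtAbs hV) fun x => by
    rw [norm_real, Real.norm_eq_abs, sq_abs, Real.sq_sqrt (abs_nonneg _)]
  have h2 := norm_sq_toLp_eq (V := V) (memLp_sqrtAbs_mul_signJ hV) fun x => by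
    rw [ofReal_mul, norm_mul, norm_signJ, mul_one, norm_real, Real.norm_eq_abs, sq_abs,
      Real.sq_sqrt (abs_nonneg _)]
  have h3 : ‖(memLp_sqrtAbs_mul_signJ hV).toLp‖ = ‖(memLp_sqrtAbs hV).toLp‖ :=
    (sq_eq_sq₀ (norm_nonneg _) (norm_nonneg _)).1 (h2.trans h1.symm)
  refine (LinearMap.mkContinuous_norm_le _ (by positivity) _).trans (le_of_eq ?_)
  rw [h3, mul_assoc, ← sq, h1]

/-- The constant `1/4` comes from `‖V‖₁ < 2√|z|`, which is exactly what the operator bound needs for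
a Neumann series. -/
theorem isUnit_of_lt_norm {V : ℝ → ℝ} (hV : Integrable V) (s : CutSide) {z : ℂ}
    (hz : potentialNorm V ^ 2 / 4 < ‖z‖) : IsUnit (1 - birmanSchwinger V hV s z) := by
  refine isUnit_one_sub_of_norm_lt_one ((norm_birmanSchwinger_le hV s z).trans_lt ?_)
  have hn : 0 ≤ potentialNorm V := integral_nonneg fun _ => abs_nonneg _
  have hsq : ‖Complex.sqrt z‖ ^ 2 = ‖z‖ := by
    rw [← norm_pow]
    simp [Complex.sqrt]
  have hlt : potentialNorm V < 2 * ‖Complex.sqrt z‖ := by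
    refine lt_of_pow_lt_pow_left₀ 2 (by positivity) ?_
    rw [mul_pow, hsq]
    linarith
  rw [norm_div, norm_mul, norm_I, RCLike.norm_ofNat, one_div, inv_mul_lt_iff₀ (by linarith),
    mul_one]
  exact hlt

theorem isUnit_of_isNuclearSum {V : ℝ → ℝ} (hV : Integrable V) (s : CutSide) {z : ℂ}
    {N : Type*} {f g : N → L2R} (h : IsNuclearSum (birmanSchwinger V hV s z) f g)
    (hz : z.im ≠ 0 ∨ 0 < z.re) : IsUnit (1 - birmanSchwinger V hV s z) :=
  isUnit_one_sub_of_isCompactOperator h.isCompactOperator fun _ hx =>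
    eq_zero_of_birmanSchwinger_apply_eq hV s hz hx

/-- A real `z` outside the ray lies below `-‖V‖₁²/4` and is covered by the norm bound. A nonreal `z`
has `Im κ > 0`, so compactness comes from the exponentially weighted expansion. -/
theorem isUnit_of_notMem_Ici {V : ℝ → ℝ} (hV : Integrable V) {z : ℂ}
    (hz : z ∉ Complex.ofReal '' Set.Ici (-(potentialNorm V ^ 2 / 4))) (s : CutSide) :
    IsUnit (1 - birmanSchwinger V hV s z) := by
  by_cases hzi : z.im = 0
  · have hzr : z = (z.re : ℂ) := by apply Complex.ext <;> simp [hzi]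
    have hlt : z.re < -(potentialNorm V ^ 2 / 4) := by
      by_contra! hle
      exact hz ⟨z.re, hle, hzr.symm⟩
    refine isUnit_of_lt_norm hV s ?_
    rw [hzr, norm_real, Real.norm_eq_abs]
    linarith [neg_abs_le z.re]
  · have hκ : 0 < (waveNumber s z).im := by
      refine lt_of_le_of_ne (waveNumber_im_nonneg s z) fun h => hzi ?_
      rw [← waveNumber_sq s z, sq, mul_im, ← h]
      ring
    exact isUnit_of_isNuclearSum hV s (isNuclearSum_of_waveNumber_im_pos hV s z hκ) (Or.inl hzi)

theorem isUnit_of_notMem_Icc {V : ℝ → ℝ} (hV : Integrable V) (hV' : MemBirmanSolomyak (1 / 2) V)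
    {z : ℂ} (hz : z ∉ Complex.ofReal '' Set.Icc (-(potentialNorm V ^ 2 / 4)) 0) (s : CutSide) :
    IsUnit (1 - birmanSchwinger V hV s z) := by
  by_cases hz' : z.im ≠ 0 ∨ 0 < z.re
  · exact isUnit_of_isNuclearSum hV s (isNuclearSum_of_memBirmanSolomyak hV hV' s z) hz'
  · push Not at hz'
    refine isUnit_of_notMem_Ici hV ?_ s
    rintro ⟨t, ht, rfl⟩
    exact hz ⟨t, ⟨ht, by simpa using hz'.2⟩, rfl⟩

end Invertibility

/-! ### Continuity of the determinant in the wave number -/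

section Continuity

open Complex ComplexConjugate

theorem continuous_blockLeft (n : BlockIndex) (x : ℝ) : Continuous fun κ => blockLeft κ n x := by
  rcases n with ⟨j, l⟩ | ⟨j, n⟩ <;> simp only [blockLeft, Set.indicator_apply] <;> split_ifs <;>
    fun_prop

theorem continuous_blockRight (n : BlockIndex) (x : ℝ) :
    Continuous fun κ => blockRight κ n x := by
  rcases n with ⟨j, l⟩ | ⟨j, n⟩ <;> simp only [blockRight, Set.indicator_apply] <;> split_ifs <;>
    fun_prop

theorem continuous_blockCoeff (n : BlockIndex) : Continuous fun κ => blockCoeff κ n := by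
  rcases n with ⟨j, l⟩ | ⟨j, n⟩
  · simp only [blockCoeff]
    split_ifs <;> fun_prop
  · exact continuous_cosCoeff n

theorem continuousOn_inner_bsRight_bsLeft {V : ℝ → ℝ} (hV : Integrable V) {S : Set ℂ}
    (hS : ∀ κ ∈ S, 0 ≤ κ.im) (hS0 : (0 : ℂ) ∉ S) (m n : BlockIndex) :
    ContinuousOn (fun κ => inner ℂ (bsRight V κ m) (bsLeft V κ n)) S := by
  have h1 : ContinuousOn (fun κ => ∫ x, ((|V x| : ℝ) : ℂ) *
      (conj ((signJ V x : ℂ) * conj (blockRight κ m x)) * blockLeft κ n x)) S := by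
    refine continuousOn_of_dominated (bound := fun x => |V x|) (fun κ _ => ?_) (fun κ hκ => ?_)
      hV.abs (ae_of_all _ fun x => ?_)
    · refine (Complex.continuous_ofReal.comp_aestronglyMeasurable hV.abs.1).mul
        ((continuous_conj.comp_aestronglyMeasurable
          (aestronglyMeasurable_signJ_mul_blockRight hV κ m)).mul
          (measurable_blockLeft κ n).aestronglyMeasurable)
    · refine ae_of_all _ fun x => ?_
      rw [norm_mul, norm_mul, norm_real, Real.norm_eq_abs, abs_abs, RCLike.norm_conj]
      exact mul_le_of_le_one_right (abs_nonneg _) (mul_le_one₀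
        (norm_signJ_mul_blockRight_le V (hS κ hκ) m x) (norm_nonneg _)
        (norm_blockLeft_le (hS κ hκ) n x))
    · exact (continuous_const.mul ((continuous_conj.comp (continuous_const.mul
        (continuous_conj.comp (continuous_blockRight m x)))).mul
        (continuous_blockLeft n x))).continuousOn
  have h2 : ContinuousOn (fun κ => -(I / (2 * κ)) * blockCoeff κ n) S := by
    refine ContinuousOn.mul (ContinuousOn.neg (ContinuousOn.div continuousOn_const
      (continuous_const.mul continuous_id).continuousOn fun κ hκ => ?_))
      (continuous_blockCoeff n).continuousOn
    exact mul_ne_zero two_ne_zero fun h => hS0 (h ▸ hκ)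
  refine (h2.mul h1).congr fun κ hκ => ?_
  rw [bsLeft, bsRight, inner_smul_right, inner_weightedVec_weightedVec hV
    (aestronglyMeasurable_signJ_mul_blockRight hV κ m)
    (norm_signJ_mul_blockRight_le V (hS κ hκ) m)
    (measurable_blockLeft κ n).aestronglyMeasurable (norm_blockLeft_le (hS κ hκ) n)]
  rfl

/-- On a compact set of `κ` away from `0` both `1/(2|κ|)` and `|κ|` are bounded, which gives one
summable majorant for all `κ`, including real ones. -/
theorem continuousOn_nuclearDet {V : ℝ → ℝ} (hV : Integrable V) (hV' : MemBirmanSolomyak (1 / 2) V)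
    {S : Set ℂ} (hSc : IsCompact S) (hS : ∀ κ ∈ S, 0 ≤ κ.im) (hS0 : (0 : ℂ) ∉ S) :
    ContinuousOn (fun κ => nuclearDet (bsLeft V κ) (bsRight V κ)) S := by
  obtain ⟨m, hm⟩ := hSc.exists_bound_of_continuousOn (f := fun κ => I / (2 * κ))
    (ContinuousOn.div continuousOn_const (continuous_const.mul continuous_id).continuousOn
      fun κ hκ => mul_ne_zero two_ne_zero fun h => hS0 (h ▸ hκ))
  obtain ⟨R, hR⟩ := hSc.exists_bound_of_continuousOn (f := fun κ : ℂ => κ) continuousOn_id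
  intro κ₀ hκ₀
  refine tendsto_nuclearDet (summable_bsBound_one hV hV'.summable_sqrt_cellMass m
    ((norm_nonneg _).trans (hR κ₀ hκ₀)))
    (fun i j => continuousOn_inner_bsRight_bsLeft hV hS hS0 i j κ₀ hκ₀) ?_
  filter_upwards [self_mem_nhdsWithin] with κ hκ n
  exact norm_bsLeft_mul_norm_bsRight_le hV (hS κ hκ) (hm κ hκ) (hR κ hκ)
    (norm_blockCoeff_inl_le (hS κ hκ)) n

/-- Every point of the closed upper half-plane is a wave number, so `nuclearDet` at that point is a
genuine Fredholm determinant. If the upper side yields `-κ`, then `κ` is real and the lower side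
reverses the sign. -/
theorem exists_waveNumber_eq {κ : ℂ} (hκ : 0 ≤ κ.im) : ∃ s, waveNumber s (κ ^ 2) = κ := by
  have hor : ∀ s, waveNumber s (κ ^ 2) = κ ∨ waveNumber s (κ ^ 2) = -κ := fun s =>
    sq_eq_sq_iff_eq_or_eq_neg.1 (waveNumber_sq s _)
  rcases hor .upper with h | h
  · exact ⟨_, h⟩
  have him : κ.im = 0 := by
    have := waveNumber_im_nonneg .upper (κ ^ 2)
    rw [h, neg_im] at this
    linarith
  refine ⟨.lower, ?_⟩
  have h0 : (Complex.sqrt (κ ^ 2)).im = 0 := by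
    have := h
    unfold waveNumber at this
    split_ifs at this
    · rw [this, neg_im, him, neg_zero]
    · rw [neg_inj] at this
      rw [this, him]
  have hup : waveNumber .upper (κ ^ 2) = Complex.sqrt (κ ^ 2) := by
    simp [waveNumber, h0]
  have hlow : waveNumber .lower (κ ^ 2) = -Complex.sqrt (κ ^ 2) := by
    simp [waveNumber, h0]
  rw [hlow, ← hup, h, neg_neg]

theorem isCompact_waveNumbers {D : Set ℂ} (hD : IsCompact D) :
    IsCompact {κ : ℂ | 0 ≤ κ.im ∧ κ ^ 2 ∈ D} := by
  obtain ⟨R, hR⟩ := hD.exists_bound_of_continuousOn (f := fun z : ℂ => z) continuousOn_id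
  refine Metric.isCompact_of_isClosed_isBounded ?_ ?_
  · exact (isClosed_le continuous_const continuous_im).inter
      (hD.isClosed.preimage (continuous_pow 2))
  · refine (Metric.isBounded_closedBall (x := (0 : ℂ)) (r := R + 1)).subset fun κ hκ => ?_
    have := hR _ hκ.2
    rw [norm_pow] at this
    rw [mem_closedBall_zero_iff]
    nlinarith [sq_nonneg (‖κ‖ - 1)]

end Continuity

/-! ### Assembly: nonvanishing and the uniform lower bound -/

theorem mainTheorem8 (V : ℝ → ℝ) (hV : Integrable V) :
    (∀ z : ℂ, z ∉ Complex.ofReal '' Set.Ici (-(potentialNorm V ^ 2 / 4)) →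
      ∀ s : CutSide, IsUnit (1 - birmanSchwinger V hV s z)) ∧
    (MemBirmanSolomyak (1 / 2) V → MemBirmanSolomyak (1 / 2) (fun x => x ^ 2 * V x) →
      (∀ z : ℂ, z ∉ Complex.ofReal '' Set.Icc (-(potentialNorm V ^ 2 / 4)) 0 →
        ∀ s : CutSide,
          IsTraceClass (birmanSchwinger V hV s z) ∧
          IsUnit (1 - birmanSchwinger V hV s z) ∧
          HasFredholmDet (1 - birmanSchwinger V hV s z)
            (fredholmDet (1 - birmanSchwinger V hV s z)) ∧
          fredholmDet (1 - birmanSchwinger V hV s z) ≠ 0) ∧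
      (∀ D : Set ℂ, IsCompact D →
        D ⊆ (Complex.ofReal '' Set.Icc (-(potentialNorm V ^ 2 / 4)) 0)ᶜ →
        ∃ c : ℝ, 0 < c ∧ ∀ z ∈ D, ∀ s : CutSide,
          c ≤ ‖fredholmDet (1 - birmanSchwinger V hV s z)‖)) := by

  refine ⟨fun z hz s => isUnit_of_notMem_Ici hV hz s, fun hV' _ => ⟨fun z hz s => ?_,
    fun D hD hDs => ?_⟩⟩
  · have hn := isNuclearSum_of_memBirmanSolomyak hV hV' s z
    have hu := isUnit_of_notMem_Icc hV hV' hz s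
    refine ⟨hn.isTraceClass, hu, ?_, ?_⟩
    · rw [hn.fredholmDet_eq]
      exact hn.hasFredholmDet
    · rw [hn.fredholmDet_eq]
      exact hn.nuclearDet_ne_zero hu
  · have hD0 : (0 : ℂ) ∉ D := fun h => hDs h ⟨0, ⟨by
      have := sq_nonneg (potentialNorm V)
      linarith, le_rfl⟩, Complex.ofReal_zero⟩
    -- The minimum is taken in `κ` rather than `z`: the two boundary values on the cut can differ,
    -- but both are values of one function continuous up to the nonzero real `κ`. Hence one constant
    -- serves both sides.
    obtain ⟨c, hc, hcle⟩ := (isCompact_waveNumbers hD).exists_forall_le'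
      (f := fun κ => ‖nuclearDet (bsLeft V κ) (bsRight V κ)‖) (a := 0)
      (continuousOn_nuclearDet hV hV' (isCompact_waveNumbers hD) (fun κ hκ => hκ.1) fun h =>
        hD0 (by simpa using h.2)).norm fun κ hκ => by
          obtain ⟨s, hs⟩ := exists_waveNumber_eq hκ.1
          have hn := isNuclearSum_of_memBirmanSolomyak hV hV' s (κ ^ 2)
          rw [hs] at hn
          exact norm_pos_iff.2 (hn.nuclearDet_ne_zero (isUnit_of_notMem_Icc hV hV' (hDs hκ.2) s))
    refine ⟨c, hc, fun z hz s => ?_⟩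
    rw [(isNuclearSum_of_memBirmanSolomyak hV hV' s z).fredholmDet_eq]
    exact hcle _ ⟨waveNumber_im_nonneg s z, by rwa [waveNumber_sq]⟩
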